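/- Let $\mathbb K$ be a field of characteristic $0$. For a linear order $\ell$ on a finite set $I$ let $a_\ell=\sum_{i\le_\ell j}\operatorname{conv}\{e_k: i\le_\ell k\le_\ell j\}\subseteq\mathbb R I$ (Minkowski sum) be the Loday associahedron. Two polytopes in $\mathbb RI$ are normally equivalent if they have the same normal fan. Let $\overline{\mathbf A}$ be the Hopf monoid in vector species over $\mathbb K$ for which $\overline{\mathbf A}[I]$ has as basis the normal equivalence classes of products $a_{\ell_1}\times\cdots\times a_{\ell_k}$, where $I=S_1\sqcup\cdots\sqcup S_k$ and $\ell_i$ is a linear order on $S_i$; its product is the product of polytopes, and its coproduct is $\Delta_{S,T}(P)=P|_S\otimes P/_S$, where $P|_S\times P/_S\subseteq\mathbb RS\times\mathbb RT$ is the face of $P$ on which $\sum_{i\in S}x_i$ is maximal. Let $\overline{\mathbf A}^*$ be the dual Hopf monoid, and let $A^*=\bigoplus_{n\ge0}\bigl(\overline{\mathbf A}^*[n]\bigr)^{\mathfrak S_n}$ be the graded Hopf algebra that the bosonic Fock functor (invariants) assigns to it; its product sums $\mu^*_{S,T}$ over all decompositions $[s+t]=S\sqcup T$ with $|S|=s$,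 $|T|=t$, and its coproduct on degree $n$ sums $\Delta^*_{S,T}$ over the decompositions of $[n]$ into an initial and a final segment. Equivalently, $A^*$ is the graded dual of the Hopf algebra $A=\bigoplus_n\overline{\mathbf A}[n]_{\mathfrak S_n}$, which has as basis the isomorphism classes (classes up to relabelling) of products of associahedra; for such a class $c$ let $c^*\in A^*$ be the dual basis element. Let $a_n$ be the isomorphism class of the associahedra $a_\ell$ with $\ell$ a linear order on an $n$-element set. Then the space $\mathcal P(A^*)=\{f\in A^*:\Delta(f)=f\otimes1+1\otimes f\}$ of primitive elements has the basis $a_1^*,a_2^*,a_3^*,\ldots$; it is a Lie algebra under the commutator $[f,g]=f\cdot g-g\cdot f$ (it is closed under the commutator and the Jacobi identity holds), and for all $s,t\ge1$ $$[a_s^*,a_t^*]=(s-t)\,a_{s+t}^*.$$ Moreover, for all $s,t\ge1$, $$a_s^*\cdot a_t^*=(s+1)\,a_{s+t}^*+\varepsilon_{s,t}\,(a_s\times a_t)^*,\qquad \varepsilon_{s,t}=\begin{cases}2&\text{if }s=t,\\1&\text{if }s\ne t.\end{cases}$$ -/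

import Mathlib

open scoped Pointwise TensorProduct DirectSum

noncomputable section

namespace DualAssoc

/-! ### Polytopes in `ℝI`, normal fans, normal equivalence -/

/-- The `y`-maximal face of `P ⊆ ℝI`, for a linear functional `y : I → ℝ` on `ℝI`. -/
def maxFace {I : Type} [Fintype I] (P : Set (I → ℝ)) (y : I → ℝ) : Set (I → ℝ) :=
  {x | x ∈ P ∧ ∀ z ∈ P, y ⬝ᵥ z ≤ y ⬝ᵥ x}

/-- The normal cone of a face `F` of `P`: the functionals `y` that attain their maximal value
on `P` at every point of `F`. -/
def normalCone {I : Type} [Fintype I] (P F : Set (I → ℝ)) : Set (I → ℝ) :=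
  {y | F ⊆ maxFace P y}

/-- The normal fan of a polytope `P`: the set of the normal cones of the (nonempty) faces of `P`.
The nonempty faces of a polytope are exactly its `y`-maximal faces. -/
def normalFan {I : Type} [Fintype I] (P : Set (I → ℝ)) : Set (Set (I → ℝ)) :=
  Set.range fun y : I → ℝ => normalCone P (maxFace P y)

/-- Relabelling `ℝI → ℝJ`, `e_i ↦ e_{σ i}`, applied to a subset of `ℝI`. -/
def relabelSet {I J : Type} (σ : I ≃ J) (P : Set (I → ℝ)) : Set (J → ℝ) :=
  {x | x ∘ σ ∈ P}

/-- The product `P × Q ⊆ ℝ(S ⊔ T)` of `P ⊆ ℝS` and `Q ⊆ ℝT`. -/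
def prodSet {S T : Type} (P : Set (S → ℝ)) (Q : Set (T → ℝ)) : Set (S ⊕ T → ℝ) :=
  {x | x ∘ Sum.inl ∈ P ∧ x ∘ Sum.inr ∈ Q}

/-! ### Associahedra -/

open Classical in
/-- The Loday associahedron `a_ℓ = ∑_{i ≤ j} Δ_{[i,j]}` (Minkowski sum) in `ℝI`, where
`Δ_{[i,j]} = conv {e_k : i ≤ k ≤ j}`, for a linear order `ℓ` on the finite set `I`. -/
def loday {I : Type} [Fintype I] (ℓ : LinearOrder I) : Set (I → ℝ) :=
  ∑ p : I × I with ℓ.le p.1 p.2,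
    convexHull ℝ {x | ∃ k : I, ℓ.le p.1 k ∧ ℓ.le k p.2 ∧ x = Pi.single k 1}

open Classical in
/-- The product of the associahedra `a_{ℓ_j}` over the blocks `S_j = {i | b i = j}` of a
decomposition `I = ⨆ S_j`, with a linear order `ℓ_j` on each block. As a decomposition of `I` has
at most `|I|` nonempty blocks, blocks are indexed by `j : I`. Blocks may be empty; these
contribute the one-point space `ℝ^∅` and do not change the product. -/
def lodayProduct {I : Type} [Fintype I] (b : I → I) (ℓ : ∀ j, LinearOrder {i // b i = j}) :
    Set (I → ℝ) :=
  {x | ∀ j, (fun i : {i // b i = j} => x i) ∈ loday (ℓ j)}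

/-- `P` is a product of associahedra `a_{ℓ_1} × ⋯ × a_{ℓ_k} ⊆ ℝI`. -/
def IsAssocProduct {I : Type} [Fintype I] (P : Set (I → ℝ)) : Prop :=
  ∃ (b : I → I) (ℓ : ∀ j, LinearOrder {i // b i = j}), P = lodayProduct b ℓ

/-! ### Helper facts -/

section Helpers

variable {I J S T : Type} [Fintype I] [Fintype J] [Fintype S] [Fintype T]

theorem isCompact_loday (ℓ : LinearOrder I) : IsCompact (loday ℓ) := by
  classical
  unfold loday
  refine Finset.sum_induction _ IsCompact (fun _ _ => IsCompact.add) isCompact_singleton ?_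
  intro p _
  apply Set.Finite.isCompact_convexHull
  refine (Set.finite_range fun k : I => (Pi.single k 1 : I → ℝ)).subset ?_
  rintro x ⟨k, -, -, rfl⟩
  exact ⟨k, rfl⟩

theorem loday_nonempty (ℓ : LinearOrder I) : (loday ℓ).Nonempty := by
  classical
  unfold loday
  refine Finset.sum_induction _ Set.Nonempty (fun _ _ => Set.Nonempty.add)
    (Set.singleton_nonempty _) ?_
  intro p hp
  refine Set.Nonempty.convexHull ⟨_, p.1, ℓ.le_refl _, (Finset.mem_filter.1 hp).2, rfl⟩

theorem lodayProduct_eq_image (b : I → I) (ℓ : ∀ j, LinearOrder {i // b i = j}) :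
    lodayProduct b ℓ = (fun (x : ∀ j, {i // b i = j} → ℝ) (i : I) => x (b i) ⟨i, rfl⟩) ''
      Set.univ.pi fun j => @loday _ (Fintype.ofFinite _) (ℓ j) := by
  classical
  have hF : ∀ j (inst : Fintype {i // b i = j}), @loday _ inst (ℓ j)
      = @loday _ (Fintype.ofFinite _) (ℓ j) := by
    intro j inst; congr!
  ext x
  constructor
  · intro hx
    refine ⟨fun j i => x i, fun j _ => ?_, rfl⟩
    change _ ∈ @loday _ (Fintype.ofFinite _) (ℓ j)
    rw [← hF j]; exact hx j
  · rintro ⟨y, hy, rfl⟩ j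
    have h := hy j trivial
    rw [hF j]
    convert h using 1
    funext i
    obtain ⟨i, rfl⟩ := i
    rfl

theorem IsAssocProduct.isCompact {P : Set (I → ℝ)} (h : IsAssocProduct P) : IsCompact P := by
  obtain ⟨b, ℓ, rfl⟩ := h
  rw [lodayProduct_eq_image]
  refine (isCompact_univ_pi fun j => @isCompact_loday _ (_) (ℓ j)).image ?_
  fun_prop

theorem IsAssocProduct.nonempty {P : Set (I → ℝ)} (h : IsAssocProduct P) : P.Nonempty := by
  obtain ⟨b, ℓ, rfl⟩ := h
  rw [lodayProduct_eq_image]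
  exact (Set.univ_pi_nonempty_iff.2 fun j => @loday_nonempty _ (_) (ℓ j)).image _

theorem IsAssocProduct.maxFace_nonempty {P : Set (I → ℝ)} (h : IsAssocProduct P) (y : I → ℝ) :
    (maxFace P y).Nonempty := by
  obtain ⟨x, hx, hm⟩ := h.isCompact.exists_isMaxOn h.nonempty
    (f := fun x => y ⬝ᵥ x) (by unfold dotProduct; fun_prop)
  exact ⟨x, hx, fun z hz => hm hz⟩

theorem normalCone_eq_of_normalFan_eq {P Q : Set (I → ℝ)} (h : normalFan P = normalFan Q)
    (y : I → ℝ) : normalCone P (maxFace P y) = normalCone Q (maxFace Q y) := by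
  have key : ∀ {P Q : Set (I → ℝ)}, normalFan P = normalFan Q →
      normalCone P (maxFace P y) ⊆ normalCone Q (maxFace Q y) := by
    intro P Q h
    have hm : normalCone Q (maxFace Q y) ∈ normalFan P := h ▸ ⟨y, rfl⟩
    obtain ⟨y', hy'⟩ := hm
    have hy : y ∈ normalCone P (maxFace P y') := by
      rw [show normalCone P (maxFace P y') = normalCone Q (maxFace Q y) from hy']
      exact Set.Subset.refl (maxFace Q y)
    rw [← hy']
    intro w hw
    have hy1 : maxFace P y' ⊆ maxFace P y := hy
    have hw1 : maxFace P y ⊆ maxFace P w := hw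
    exact hy1.trans hw1
  exact Set.Subset.antisymm (key h) (key h.symm)

theorem normalFan_relabelSet (σ : I ≃ J) (P : Set (I → ℝ)) :
    normalFan (relabelSet σ P) = relabelSet σ '' normalFan P := by
  have hd : ∀ (y x : J → ℝ), y ⬝ᵥ x = (y ∘ σ) ⬝ᵥ (x ∘ σ) := by
    intro y x; exact (Equiv.sum_comp σ fun j => y j * x j).symm
  have hs : ∀ z : I → ℝ, (z ∘ σ.symm) ∘ σ = z := by intro z; ext; simp
  have hF : ∀ y, maxFace (relabelSet σ P) y = relabelSet σ (maxFace P (y ∘ σ)) := by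
    intro y; ext x
    constructor
    · rintro ⟨hx, hm⟩
      refine ⟨hx, fun z hz => ?_⟩
      have := hm (z ∘ σ.symm) (by change _ ∈ P; rwa [hs])
      rwa [hd y, hd y, hs] at this
    · rintro ⟨hx, hm⟩
      refine ⟨hx, fun z hz => ?_⟩
      rw [hd y, hd y]; exact hm _ hz
  have hsub : ∀ A B : Set (I → ℝ), relabelSet σ A ⊆ relabelSet σ B ↔ A ⊆ B := by
    intro A B
    constructor
    · intro h z hz
      have := @h (z ∘ σ.symm) (by change _ ∈ A; rwa [hs])
      change _ ∈ B at this; rwa [hs] at this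
    · intro h x hx; exact h hx
  have hN : ∀ y, normalCone (relabelSet σ P) (maxFace (relabelSet σ P) y)
      = relabelSet σ (normalCone P (maxFace P (y ∘ σ))) := by
    intro y; ext w
    change maxFace (relabelSet σ P) y ⊆ maxFace (relabelSet σ P) w ↔ _
    rw [hF, hF, hsub]; rfl
  ext C
  constructor
  · rintro ⟨y, rfl⟩
    exact ⟨_, ⟨y ∘ σ, rfl⟩, (hN y).symm⟩
  · rintro ⟨_, ⟨y, rfl⟩, rfl⟩
    refine ⟨y ∘ σ.symm, ?_⟩
    change normalCone _ _ = _
    rw [hN, hs]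

theorem normalFan_prodSet {P : Set (S → ℝ)} {Q : Set (T → ℝ)} (hP : IsAssocProduct P)
    (hQ : IsAssocProduct Q) : normalFan (prodSet P Q) =
      Set.range fun y : S ⊕ T → ℝ => prodSet (normalCone P (maxFace P (y ∘ Sum.inl)))
        (normalCone Q (maxFace Q (y ∘ Sum.inr))) := by
  have hd : ∀ (y x : S ⊕ T → ℝ), y ⬝ᵥ x
      = (y ∘ Sum.inl) ⬝ᵥ (x ∘ Sum.inl) + (y ∘ Sum.inr) ⬝ᵥ (x ∘ Sum.inr) := by
    intro y x; simp [dotProduct]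
  have hF : ∀ y, maxFace (prodSet P Q) y
      = prodSet (maxFace P (y ∘ Sum.inl)) (maxFace Q (y ∘ Sum.inr)) := by
    intro y; ext x
    constructor
    · rintro ⟨hx, hm⟩
      refine ⟨⟨hx.1, fun z hz => ?_⟩, ⟨hx.2, fun z hz => ?_⟩⟩
      · have := hm (Sum.elim z (x ∘ Sum.inr)) ⟨by simpa using hz, by simpa using hx.2⟩
        rw [hd, hd y x] at this; simpa using this
      · have := hm (Sum.elim (x ∘ Sum.inl) z) ⟨by simpa using hx.1, by simpa using hz⟩
        rw [hd, hd y x] at this; simpa using this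
    · rintro ⟨⟨h1, h1'⟩, ⟨h2, h2'⟩⟩
      refine ⟨⟨h1, h2⟩, fun z hz => ?_⟩
      rw [hd, hd y x]; exact add_le_add (h1' _ hz.1) (h2' _ hz.2)
  unfold normalFan
  congr 1
  funext y
  ext w
  change maxFace (prodSet P Q) y ⊆ maxFace (prodSet P Q) w ↔
    maxFace P _ ⊆ maxFace P _ ∧ maxFace Q _ ⊆ maxFace Q _
  rw [hF, hF]
  obtain ⟨p, hp⟩ := hP.maxFace_nonempty (y ∘ Sum.inl)
  obtain ⟨q, hq⟩ := hQ.maxFace_nonempty (y ∘ Sum.inr)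
  constructor
  · intro h
    refine ⟨fun z hz => ?_, fun z hz => ?_⟩
    · have := @h (Sum.elim z q) ⟨by simpa using hz, by simpa using hq⟩
      simpa using this.1
    · have := @h (Sum.elim p z) ⟨by simpa using hp, by simpa using hz⟩
      simpa using this.2
  · rintro ⟨h1, h2⟩ x ⟨hx1, hx2⟩
    exact ⟨h1 hx1, h2 hx2⟩

theorem loday_relabel (σ : I ≃ J) (ℓ : LinearOrder I) (m : LinearOrder J)
    (h : ∀ a c, m.le (σ a) (σ c) ↔ ℓ.le a c) : relabelSet σ (loday ℓ) = loday m := by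
  classical
  let L : (I → ℝ) ≃ₗ[ℝ] (J → ℝ) := LinearEquiv.funCongrLeft ℝ ℝ σ.symm
  have hL : ∀ A : Set (I → ℝ), relabelSet σ A = L '' A := by
    intro A; ext x
    constructor
    · intro hx
      refine ⟨x ∘ σ, hx, ?_⟩
      ext j; simp [L, LinearEquiv.funCongrLeft, LinearMap.funLeft]
    · rintro ⟨z, hz, rfl⟩
      change (L z) ∘ σ ∈ A
      convert hz using 1
      ext i; simp [L, LinearEquiv.funCongrLeft, LinearMap.funLeft]
  rw [hL]
  unfold loday
  rw [Set.image_finsetSum]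
  refine Finset.sum_equiv (σ.prodCongr σ) ?_ ?_
  · intro p; simp [h]
  · intro p _
    rw [show (⇑L) = ⇑(L.toLinearMap) from rfl, LinearMap.image_convexHull]
    congr 1
    have hsing : ∀ k, L (Pi.single k 1) = (Pi.single (σ k) 1 : J → ℝ) := by
      intro k; ext j
      simp [L, LinearEquiv.funCongrLeft, LinearMap.funLeft, Pi.single_apply, Equiv.symm_apply_eq]
    ext x
    constructor
    · rintro ⟨_, ⟨k, h1, h2, rfl⟩, rfl⟩
      exact ⟨σ k, (h _ _).2 h1, (h _ _).2 h2, hsing k⟩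
    · rintro ⟨k, h1, h2, rfl⟩
      refine ⟨_, ⟨σ.symm k, ?_, ?_, rfl⟩, ?_⟩
      · rw [← h]; simpa using h1
      · rw [← h]; simpa using h2
      · exact (hsing _).trans (by rw [σ.apply_symm_apply])

/-- A product of associahedra may be recognised after any reindexing of the blocks. -/
theorem isAssocProduct_of_blocks (b : I → I) (X : I → Type) [∀ j, Fintype (X j)]
    (φ : ∀ j, X j ≃ {i // b i = j}) (ℓ : ∀ j, LinearOrder (X j)) :
    IsAssocProduct {x : I → ℝ | ∀ j, (fun i : X j => x (φ j i)) ∈ loday (ℓ j)} := by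
  classical
  refine ⟨b, fun j => @LinearOrder.lift' _ _ (ℓ j) (φ j).symm (φ j).symm.injective, ?_⟩
  ext x
  refine forall_congr' fun j => ?_
  rw [← loday_relabel (φ j) (ℓ j)]
  · rfl
  · intro a c
    change (ℓ j).le ((φ j).symm _) ((φ j).symm _) ↔ _
    simp

theorem IsAssocProduct.relabelSet {P : Set (I → ℝ)} (h : IsAssocProduct P) (σ : I ≃ J) :
    IsAssocProduct (relabelSet σ P) := by
  classical
  obtain ⟨b, ℓ, rfl⟩ := h
  have := isAssocProduct_of_blocks (fun j => σ (b (σ.symm j)))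
    (fun j => {i // b i = σ.symm j})
    (fun j => σ.subtypeEquiv fun i => by simp [Equiv.eq_symm_apply]) (fun j => ℓ (σ.symm j))
  convert this using 1
  ext x
  constructor
  · intro hx j; exact hx (σ.symm j)
  · intro hx i
    have := hx (σ i)
    simp only [Equiv.subtypeEquiv_apply] at this
    rw [σ.symm_apply_apply] at this
    exact this

theorem IsAssocProduct.prodSet {P : Set (S → ℝ)} {Q : Set (T → ℝ)} (hP : IsAssocProduct P)
    (hQ : IsAssocProduct Q) : IsAssocProduct (prodSet P Q) := by
  classical
  obtain ⟨b, ℓ, rfl⟩ := hP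
  obtain ⟨c, m, rfl⟩ := hQ
  let φ₁ : ∀ j : S, {i // b i = j} ≃ {i : S ⊕ T // Sum.map b c i = Sum.inl j} := fun j =>
    { toFun := fun i => ⟨Sum.inl i.1, by simp [i.2]⟩
      invFun := fun i => match i with
        | ⟨Sum.inl i, h⟩ => ⟨i, by simpa using h⟩
        | ⟨Sum.inr i, h⟩ => by simp at h
      left_inv := fun i => rfl
      right_inv := fun i => match i with
        | ⟨Sum.inl i, h⟩ => rfl
        | ⟨Sum.inr i, h⟩ => by simp at h }
  let φ₂ : ∀ j : T, {i // c i = j} ≃ {i : S ⊕ T // Sum.map b c i = Sum.inr j} := fun j =>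
    { toFun := fun i => ⟨Sum.inr i.1, by simp [i.2]⟩
      invFun := fun i => match i with
        | ⟨Sum.inr i, h⟩ => ⟨i, by simpa using h⟩
        | ⟨Sum.inl i, h⟩ => by simp at h
      left_inv := fun i => rfl
      right_inv := fun i => match i with
        | ⟨Sum.inr i, h⟩ => rfl
        | ⟨Sum.inl i, h⟩ => by simp at h }
  let X : S ⊕ T → Type := Sum.elim (fun j => {i // b i = j}) (fun j => {i // c i = j})
  let i₁ : ∀ j, Fintype {i // b i = j} := fun j => Subtype.fintype _
  let i₂ : ∀ j, Fintype {i // c i = j} := fun j => Subtype.fintype _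
  let _ : ∀ j, Fintype (X j) := fun j => Sum.rec i₁ i₂ j
  have := isAssocProduct_of_blocks (Sum.map b c) X
    (fun j => match j with
      | Sum.inl j => φ₁ j
      | Sum.inr j => φ₂ j)
    (fun j => match j with
      | Sum.inl j => ℓ j
      | Sum.inr j => m j)
  convert this using 1
  ext x
  constructor
  · rintro ⟨h1, h2⟩ (j | j)
    · exact h1 j
    · exact h2 j
  · intro h
    exact ⟨fun j => h (Sum.inl j), fun j => h (Sum.inr j)⟩

theorem isAssocProduct_loday (ℓ : LinearOrder I) : IsAssocProduct (loday ℓ) := by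
  classical
  cases isEmpty_or_nonempty I with
  | inl hI =>
    refine ⟨id, fun j => (hI.false j).elim, ?_⟩
    ext x
    refine ⟨fun _ j => (hI.false j).elim, fun _ => ?_⟩
    obtain ⟨y, hy⟩ := loday_nonempty ℓ
    rwa [Subsingleton.elim x y]
  | inr hI =>
    obtain ⟨i₀⟩ := hI
    let X : I → Type := fun j => {_i : I // i₀ = j}
    have := isAssocProduct_of_blocks (fun _ : I => i₀) (fun j => {_i : I // i₀ = j})
      (fun j => Equiv.refl _)
      (fun j => @LinearOrder.lift' _ _ ℓ Subtype.val Subtype.val_injective)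
    convert this using 1
    ext x
    have key : x ∈ loday ℓ ↔ (fun i : {_i : I // i₀ = i₀} => x i.1) ∈
        loday (@LinearOrder.lift' {_i : I // i₀ = i₀} _ ℓ Subtype.val Subtype.val_injective) := by
      rw [← loday_relabel ((Equiv.subtypeUnivEquiv (p := fun _ : I => i₀ = i₀)
        fun _ => rfl).symm) ℓ]
      · rfl
      · intro a c; rfl
    constructor
    · intro hx j
      by_cases hj : i₀ = j
      · subst hj; exact key.1 hx
      · have : IsEmpty {_i : I // i₀ = j} := ⟨fun i => hj i.2⟩
        obtain ⟨y, hy⟩ := loday_nonempty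
          (@LinearOrder.lift' {_i : I // i₀ = j} _ ℓ Subtype.val Subtype.val_injective)
        rwa [Subsingleton.elim y] at hy
    · intro hx
      exact key.2 (hx i₀)

end Helpers

/-! ### The Hopf monoid of associahedra up to normal equivalence -/

/-- Normal equivalence of products of associahedra in `ℝI`: equality of the normal fans. -/
def normalEquiv (I : Type) [Fintype I] : Setoid {P : Set (I → ℝ) // IsAssocProduct P} :=
  Setoid.ker fun P => normalFan P.1

/-- The normal equivalence classes of products of associahedra in `ℝI`. -/
def AssocClass (I : Type) [Fintype I] : Type := Quotient (normalEquiv I)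

/-- The class of a product of associahedra. -/
def AssocClass.mk {I : Type} [Fintype I] (P : Set (I → ℝ)) (h : IsAssocProduct P) :
    AssocClass I := Quotient.mk (normalEquiv I) ⟨P, h⟩

/-- The common normal fan of the members of a class. -/
def AssocClass.fan {I : Type} [Fintype I] (z : AssocClass I) : Set (Set (I → ℝ)) :=
  Quotient.lift (fun P : {P : Set (I → ℝ) // IsAssocProduct P} => normalFan P.1)
    (fun _ _ h => h) z

/-- The class of the associahedron `a_ℓ`. -/
def AssocClass.assoc {I : Type} [Fintype I] (ℓ : LinearOrder I) : AssocClass I :=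
  .mk (loday ℓ) (isAssocProduct_loday ℓ)

/-- Relabelling of classes along a bijection. -/
def AssocClass.relabel {I J : Type} [Fintype I] [Fintype J] (σ : I ≃ J) :
    AssocClass I → AssocClass J :=
  Quotient.map (fun P => ⟨relabelSet σ P.1, P.2.relabelSet σ⟩) (by
    intro P Q h
    change normalFan (relabelSet σ P.1) = normalFan (relabelSet σ Q.1)
    rw [normalFan_relabelSet, normalFan_relabelSet, show normalFan P.1 = normalFan Q.1 from h])

/-- The product `P × Q` of classes. -/
def AssocClass.prod {S T : Type} [Fintype S] [Fintype T] :
    AssocClass S → AssocClass T → AssocClass (S ⊕ T) :=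
  Quotient.map₂ (fun P Q => ⟨prodSet P.1 Q.1, P.2.prodSet Q.2⟩) (by
    intro P P' h Q Q' h'
    change normalFan (prodSet P.1 Q.1) = normalFan (prodSet P'.1 Q'.1)
    rw [normalFan_prodSet P.2 Q.2, normalFan_prodSet P'.2 Q'.2]
    congr 1
    funext y
    rw [normalCone_eq_of_normalFan_eq h, normalCone_eq_of_normalFan_eq h'])

instance AssocClass.finite (I : Type) [Fintype I] : Finite (AssocClass I) := by
  classical
  have : ∀ (b : I → I) (j : I), Finite (LinearOrder {i // b i = j}) := fun b j =>
    Finite.of_injective (fun ℓ : LinearOrder {i // b i = j} => ℓ.le) fun ℓ m h =>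
      LinearOrder.toPartialOrder_injective (PartialOrder.ext fun x y =>
        iff_of_eq (congrFun (congrFun h x) y))
  refine Finite.of_surjective
    (fun d : (Σ b : I → I, ∀ j, LinearOrder {i // b i = j}) =>
      AssocClass.mk (lodayProduct d.1 d.2) ⟨d.1, d.2, rfl⟩) ?_
  intro z
  induction z using Quotient.inductionOn with
  | h P =>
    obtain ⟨P, b, ℓ, rfl⟩ := P
    exact ⟨⟨b, ℓ⟩, rfl⟩

/-- `Δ_{S,T}(z) = x ⊗ y` for classes `z`, `x = z|_S`, `y = z/_S` in the Hopf monoid of generalized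
permutahedra up to normal equivalence: for a polytope `P` in the class `z`, the `𝟙_S`-maximal face
of `P` is a product `A × B ⊆ ℝS × ℝT` with `A` in the class `x` and `B` in the class `y`. -/
def IsCoproduct {S T : Type} [Fintype S] [Fintype T] (z : AssocClass (S ⊕ T))
    (x : AssocClass S) (y : AssocClass T) : Prop :=
  ∃ (P : Set (S ⊕ T → ℝ)) (A : Set (S → ℝ)) (B : Set (T → ℝ)),
    IsAssocProduct P ∧ normalFan P = z.fan ∧
    maxFace P (Sum.elim (fun _ => 1) (fun _ => 0)) = prodSet A B ∧
    normalFan A = x.fan ∧ normalFan B = y.fan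

variable (K : Type*) [Field K]

/-- The vector species of associahedra: `Ā[I]` is the vector space with basis the classes of
products of associahedra in `ℝI`. -/
abbrev Abar (I : Type) [Fintype I] : Type _ := AssocClass I →₀ K

/-- The relabelling map `Ā[σ] : Ā[I] → Ā[J]`. -/
def Abar.relabel {I J : Type} [Fintype I] [Fintype J] (σ : I ≃ J) : Abar K I →ₗ[K] Abar K J :=
  Finsupp.lmapDomain K K (AssocClass.relabel σ)

/-- The product `μ_{S,T} : Ā[S] ⊗ Ā[T] → Ā[S ⊔ T]`. -/
def Abar.mul (S T : Type) [Fintype S] [Fintype T] :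
    Abar K S ⊗[K] Abar K T →ₗ[K] Abar K (S ⊕ T) :=
  TensorProduct.lift (Finsupp.lift _ K _ fun x => Finsupp.lift _ K _ fun y =>
    Finsupp.single (x.prod y) 1)

/-- The coproduct `Δ_{S,T} : Ā[S ⊔ T] → Ā[S] ⊗ Ā[T]`, with `Δ_{S,T}(z) = z|_S ⊗ z/_S` on basis
elements: for each class `z` there is exactly one pair `(x, y) = (z|_S, z/_S)` as in the sum. -/
def Abar.comul (S T : Type) [Fintype S] [Fintype T] :
    Abar K (S ⊕ T) →ₗ[K] Abar K S ⊗[K] Abar K T :=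
  Finsupp.lift _ K _ fun z =>
    ∑ᶠ (p : AssocClass S × AssocClass T) (_ : IsCoproduct z p.1 p.2),
      (Finsupp.single p.1 1 : Abar K S) ⊗ₜ[K] (Finsupp.single p.2 1 : Abar K T)

/-! ### The dual Hopf monoid `Ā*` -/

/-- The dual vector species, `Ā*[I] = (Ā[I])^*`. -/
abbrev AbarDual (I : Type) [Fintype I] : Type _ := Module.Dual K (Abar K I)

/-- The relabelling map `Ā*[σ] : Ā*[I] → Ā*[J]`, the transpose of `Ā[σ⁻¹]`. -/
def AbarDual.relabel {I J : Type} [Fintype I] [Fintype J] (σ : I ≃ J) :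
    AbarDual K I →ₗ[K] AbarDual K J :=
  (Abar.relabel K σ.symm).dualMap

/-- The product `μ*_{S,T} : Ā*[S] ⊗ Ā*[T] → Ā*[S ⊔ T]`, the transpose of `Δ_{S,T}`. -/
def AbarDual.mul (S T : Type) [Fintype S] [Fintype T] :
    AbarDual K S ⊗[K] AbarDual K T →ₗ[K] AbarDual K (S ⊕ T) :=
  (Abar.comul K S T).dualMap ∘ₗ TensorProduct.dualDistrib K (Abar K S) (Abar K T)

/-- The coproduct `Δ*_{S,T} : Ā*[S ⊔ T] → Ā*[S] ⊗ Ā*[T]`, the transpose of `μ_{S,T}`. -/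
def AbarDual.comul (S T : Type) [Fintype S] [Fintype T] :
    AbarDual K (S ⊕ T) →ₗ[K] AbarDual K S ⊗[K] AbarDual K T :=
  (TensorProduct.dualDistribEquiv K (Abar K S) (Abar K T)).symm.toLinearMap ∘ₗ
    (Abar.mul K S T).dualMap

/-! ### The Fock functor applied to `Ā*` -/

/-- The graded vector space `⨁ₙ Ā*[n]`, `[n] = Fin n`. -/
abbrev FullFock : Type _ := ⨁ n : ℕ, AbarDual K (Fin n)

/-- The inclusion of `Ā*[n]`. -/
abbrev FullFock.of (n : ℕ) : AbarDual K (Fin n) →ₗ[K] FullFock K :=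
  DirectSum.lof K ℕ (fun n => AbarDual K (Fin n)) n

/-- The component `Ā*[s] ⊗ Ā*[t] → Ā*[s + t]` of the product: the sum of `μ*_{S,T}` over all
decompositions `[s + t] = S ⊔ T` with `|S| = s`, where `[s]` and `[t]` are identified with
`S` and `T` by the order-preserving bijections. -/
def FullFock.mulComponent (s t : ℕ) :
    AbarDual K (Fin s) ⊗[K] AbarDual K (Fin t) →ₗ[K] AbarDual K (Fin (s + t)) :=
  ∑ S : {S : Finset (Fin (s + t)) // S.card = s},
    AbarDual.relabel K (finSumEquivOfFinset (n := t) S.2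
      (by rw [Finset.card_compl, S.2, Fintype.card_fin, Nat.add_sub_cancel_left])) ∘ₗ
    AbarDual.mul K (Fin s) (Fin t)

/-- The product of `⨁ₙ Ā*[n]`. -/
def FullFock.mul : FullFock K →ₗ[K] FullFock K →ₗ[K] FullFock K :=
  DirectSum.toModule K ℕ _ fun s => LinearMap.flip (DirectSum.toModule K ℕ _ fun t =>
    LinearMap.flip (TensorProduct.curry (FullFock.of K (s + t) ∘ₗ FullFock.mulComponent K s t)))

/-- The coproduct of `⨁ₙ Ā*[n]`: on `Ā*[n]` it is the sum over `s + t = n` of `Δ*_{S,T}` for the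
decomposition of `[n]` into its first `s` and its last `t` elements. -/
def FullFock.comul : FullFock K →ₗ[K] FullFock K ⊗[K] FullFock K :=
  DirectSum.toModule K ℕ _ fun n => ∑ p : {p : ℕ × ℕ // p ∈ Finset.HasAntidiagonal.antidiagonal n},
    TensorProduct.map (FullFock.of K p.1.1) (FullFock.of K p.1.2) ∘ₗ
    AbarDual.comul K (Fin p.1.1) (Fin p.1.2) ∘ₗ
    AbarDual.relabel K
      (finSumFinEquiv.trans (finCongr (Finset.HasAntidiagonal.mem_antidiagonal.1 p.2))).symm

/-- The unit: the element of `Ā*[0]` that is `1` on the basis element (the point `ℝ^∅`) of the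
one-dimensional space `Ā[0]`. -/
def FullFock.one : FullFock K :=
  FullFock.of K 0 (Finsupp.lift K K _ fun _ => 1)

/-- The Hopf algebra `A*` that the (bosonic) Fock functor assigns to the dual Hopf monoid `Ā*`:
the elements of `⨁ₙ Ā*[n]` whose components are invariant under relabelling by the symmetric
groups, with the operations of `⨁ₙ Ā*[n]`. Its degree `n` part, the invariants of `Ā[n]^*`, is the
dual space of the coinvariants of `Ā[n]`. -/
def FockAlg : Submodule K (FullFock K) where
  carrier := {f | ∀ (n : ℕ) (σ : Equiv.Perm (Fin n)), AbarDual.relabel K σ (f n) = f n}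
  add_mem' := by
    intro f g hf hg n σ
    rw [DirectSum.add_apply, map_add, hf, hg]
  zero_mem' := by
    intro n σ
    rw [DirectSum.zero_apply, map_zero]
  smul_mem' := by
    intro c f hf n σ
    rw [DirectSum.smul_apply, map_smul, hf]

/-- The primitive elements `f` of `A*`: `Δ(f) = f ⊗ 1 + 1 ⊗ f`. -/
def primitives : Submodule K (FullFock K) where
  carrier := {f | f ∈ FockAlg K ∧
    FullFock.comul K f = f ⊗ₜ[K] FullFock.one K + FullFock.one K ⊗ₜ[K] f}
  add_mem' := by
    rintro f g ⟨hf, hf'⟩ ⟨hg, hg'⟩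
    refine ⟨add_mem hf hg, ?_⟩
    rw [map_add, hf', hg', TensorProduct.add_tmul, TensorProduct.tmul_add]
    abel
  zero_mem' := ⟨zero_mem _, by
    rw [map_zero, TensorProduct.zero_tmul, TensorProduct.tmul_zero, add_zero]⟩
  smul_mem' := by
    rintro c f ⟨hf, hf'⟩
    refine ⟨Submodule.smul_mem _ c hf, ?_⟩
    rw [map_smul, hf', TensorProduct.tmul_smul, ← TensorProduct.smul_tmul', smul_add]

/-- The commutator `[f, g] = f · g - g · f`. -/
def bracket (f g : FullFock K) : FullFock K :=
  FullFock.mul K f g - FullFock.mul K g f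

open Classical in
/-- The basis element `c^*` of `A*` dual to the isomorphism class `c` of `z`: the functional on
`Ā[n]` that is `1` on the basis elements isomorphic to `z` (that is, equal to `z` up to
relabelling) and `0` on all other basis elements. -/
def isoDual {n : ℕ} (z : AssocClass (Fin n)) : FullFock K :=
  FullFock.of K n (Finsupp.lift K K _ fun w =>
    if ∃ σ : Equiv.Perm (Fin n), z.relabel σ = w then 1 else 0)

/-- The associahedron on `[n]` with the standard linear order. -/
def stdAssoc (n : ℕ) : AssocClass (Fin n) := .assoc (inferInstance : LinearOrder (Fin n))

/-- `a_n^*`, dual to the isomorphism class `a_n` of the associahedra `a_ℓ`, `ℓ` a linear order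
on an `n`-element set. -/
def assocDual (n : ℕ) : FullFock K := isoDual K (stdAssoc n)

/-- `(a_s × a_t)^*`, dual to the isomorphism class of `a_s × a_t`. -/
def assocProdDual (s t : ℕ) : FullFock K :=
  isoDual K (((stdAssoc s).prod (stdAssoc t)).relabel finSumFinEquiv)

end DualAssoc

end

/-!
A product of associahedra is a Minkowski sum of simplices `Δ_A`, where `A` runs over the intervals
inside its blocks (`isBlockPolytope_lodayProduct`). The face of such a sum on which a functional `y`
is maximal is the sum of the simplices on the sets where `y` attains its maximum over `A`
(`maxFace_hypergraphic`). Hence the normal fan amounts to a combinatorial relation between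
functionals, `ArgmaxLE`, which depends only on the set of the intervals. Two consequences carry the
proof.

* The fan determines the partition into blocks, because its lineality space consists of the
  functionals that are constant on blocks (`HasBlocks.label_eq_iff`). So a class is isomorphic to
  `a_n` exactly if it has one block, and to `a_s × a_t` exactly if its blocks are a set of `s`
  elements and its complement.
* The coproduct is computed from blocks: `z|_S` has the blocks of `z` intersected with `S`, and
  `z/_S` has the blocks of `z` cut at the elements of `S` (`HasBlocks.exists_isCoproduct`). It is
  well defined on classes, because for large `N` the `y`-maximal face of the `𝟙_S`-maximal face is
  the `(N 𝟙_S + y)`-maximal face (`argmax_argmax`, `IsCoproduct.unique`).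

The coefficient of `a_s^* · a_t^*` at a class `w` is therefore the number of `s`-element sets `S`
that lie in one block of `w` and whose complement lies in one block without being separated by `S`
(`mulComponent_isoFun_single`). If `w` has one block, the complement of `S` is an interval with `t`
elements, and there are `s + 1` of these. If `w` has more than one block, `S` and its complement
have to be the blocks of `w`, which leaves two choices if `w` has two blocks of equal size, one if
it has blocks of different sizes `s` and `t`, and none otherwise. The formula for the commutator follows, as
`(a_s × a_t)^*` is symmetric in `s` and `t`.

A functional `f` is primitive exactly if it vanishes in degree `0` and on all products of two
nontrivial classes (`apply_prod_of_mem_primitives`, `assocDual_mem_primitives`). Every class with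
more than one block is such a product and no class with one block is, so the primitive elements are
spanned by the `a_n^*` with `n ≥ 1`. Closure under the commutator and the Jacobi identity are then
checked on this basis.
-/

noncomputable section

namespace DualAssoc

/-! ### Faces and normal fans -/

section Polytopes

variable {I J S T ι κ : Type} [Fintype I] [Fintype J] [Fintype S] [Fintype T]
  [Fintype ι] [Fintype κ]

/-- A functional `w` lies in every cone of the normal fan containing `y` exactly if the `y`-maximal
face is contained in the `w`-maximal face. -/
theorem forall_mem_normalFan_iff (P : Set (I → ℝ)) (y w : I → ℝ) :
    (∀ C ∈ normalFan P, y ∈ C → w ∈ C) ↔ maxFace P y ⊆ maxFace P w := by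
  constructor
  · intro h
    exact h _ ⟨y, rfl⟩ (Set.Subset.refl (maxFace P y))
  · rintro h _ ⟨u, rfl⟩ hy
    exact Set.Subset.trans hy h

theorem normalFan_eq_iff {P Q : Set (I → ℝ)} : normalFan P = normalFan Q ↔
    ∀ y w, maxFace P y ⊆ maxFace P w ↔ maxFace Q y ⊆ maxFace Q w := by
  constructor
  · intro h y w
    rw [← forall_mem_normalFan_iff, ← forall_mem_normalFan_iff, h]
  · intro h
    unfold normalFan
    congr 1
    funext y
    ext w
    exact h y w

theorem maxFace_prodSet (P : Set (S → ℝ)) (Q : Set (T → ℝ)) (y : S ⊕ T → ℝ) :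
    maxFace (prodSet P Q) y =
      prodSet (maxFace P (y ∘ Sum.inl)) (maxFace Q (y ∘ Sum.inr)) := by
  have hd : ∀ (y x : S ⊕ T → ℝ), y ⬝ᵥ x
      = (y ∘ Sum.inl) ⬝ᵥ (x ∘ Sum.inl) + (y ∘ Sum.inr) ⬝ᵥ (x ∘ Sum.inr) := by
    intro y x; simp [dotProduct]
  ext x
  constructor
  · rintro ⟨hx, hm⟩
    refine ⟨⟨hx.1, fun z hz => ?_⟩, ⟨hx.2, fun z hz => ?_⟩⟩
    · have := hm (Sum.elim z (x ∘ Sum.inr)) ⟨by simpa using hz, by simpa using hx.2⟩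
      rw [hd, hd y x] at this; simpa using this
    · have := hm (Sum.elim (x ∘ Sum.inl) z) ⟨by simpa using hx.1, by simpa using hz⟩
      rw [hd, hd y x] at this; simpa using this
  · rintro ⟨⟨h1, h1'⟩, ⟨h2, h2'⟩⟩
    refine ⟨⟨h1, h2⟩, fun z hz => ?_⟩
    rw [hd, hd y x]; exact add_le_add (h1' _ hz.1) (h2' _ hz.2)

omit [Fintype S] [Fintype T] in
theorem prodSet_subset_prodSet_iff {P P' : Set (S → ℝ)} {Q Q' : Set (T → ℝ)}
    (hP : P.Nonempty) (hQ : Q.Nonempty) :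
    prodSet P Q ⊆ prodSet P' Q' ↔ P ⊆ P' ∧ Q ⊆ Q' := by
  obtain ⟨p, hp⟩ := hP
  obtain ⟨q, hq⟩ := hQ
  constructor
  · intro h
    refine ⟨fun z hz => ?_, fun z hz => ?_⟩
    · have := @h (Sum.elim z q) ⟨by simpa using hz, by simpa using hq⟩
      simpa using this.1
    · have := @h (Sum.elim p z) ⟨by simpa using hp, by simpa using hz⟩
      simpa using this.2
  · rintro ⟨h1, h2⟩ x ⟨hx1, hx2⟩
    exact ⟨h1 hx1, h2 hx2⟩

@[simp] theorem maxFace_zero (P : Set (I → ℝ)) : maxFace P 0 = P := by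
  ext x; simp [maxFace]

/-- The normal fan of a product determines the normal fans of its factors. -/
theorem normalFan_eq_of_prodSet {A A' : Set (S → ℝ)} {B B' : Set (T → ℝ)}
    (hA : ∀ y, (maxFace A y).Nonempty) (hB : ∀ y, (maxFace B y).Nonempty)
    (hA' : ∀ y, (maxFace A' y).Nonempty) (hB' : ∀ y, (maxFace B' y).Nonempty)
    (h : normalFan (prodSet A B) = normalFan (prodSet A' B')) :
    normalFan A = normalFan A' ∧ normalFan B = normalFan B' := by
  rw [normalFan_eq_iff] at h
  have key : ∀ y w : S ⊕ T → ℝ,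
      (maxFace A (y ∘ Sum.inl) ⊆ maxFace A (w ∘ Sum.inl) ∧
        maxFace B (y ∘ Sum.inr) ⊆ maxFace B (w ∘ Sum.inr)) ↔
      (maxFace A' (y ∘ Sum.inl) ⊆ maxFace A' (w ∘ Sum.inl) ∧
        maxFace B' (y ∘ Sum.inr) ⊆ maxFace B' (w ∘ Sum.inr)) := by
    intro y w
    have := h y w
    rwa [maxFace_prodSet, maxFace_prodSet, maxFace_prodSet, maxFace_prodSet,
      prodSet_subset_prodSet_iff (hA _) (hB _), prodSet_subset_prodSet_iff (hA' _) (hB' _)] at this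
  constructor
  · rw [normalFan_eq_iff]
    intro y w
    simpa using key (Sum.elim y 0) (Sum.elim w 0)
  · rw [normalFan_eq_iff]
    intro y w
    simpa using key (Sum.elim 0 y) (Sum.elim 0 w)

theorem maxFace_relabelSet (σ : I ≃ J) (P : Set (I → ℝ)) (y : J → ℝ) :
    maxFace (relabelSet σ P) y = relabelSet σ (maxFace P (y ∘ σ)) := by
  have hd : ∀ (y x : J → ℝ), y ⬝ᵥ x = (y ∘ σ) ⬝ᵥ (x ∘ σ) := by
    intro y x; exact (Equiv.sum_comp σ fun j => y j * x j).symm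
  have hs : ∀ z : I → ℝ, (z ∘ σ.symm) ∘ σ = z := by intro z; ext; simp
  ext x
  constructor
  · rintro ⟨hx, hm⟩
    refine ⟨hx, fun z hz => ?_⟩
    have := hm (z ∘ σ.symm) (by change _ ∈ P; rwa [hs])
    rwa [hd y, hd y, hs] at this
  · rintro ⟨hx, hm⟩
    refine ⟨hx, fun z hz => ?_⟩
    rw [hd y, hd y]; exact hm _ hz

omit [Fintype I] [Fintype J] in
theorem relabelSet_subset_relabelSet_iff (σ : I ≃ J) (A B : Set (I → ℝ)) :
    relabelSet σ A ⊆ relabelSet σ B ↔ A ⊆ B := by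
  have hs : ∀ z : I → ℝ, (z ∘ σ.symm) ∘ σ = z := by intro z; ext; simp
  constructor
  · intro h z hz
    have := @h (z ∘ σ.symm) (by change _ ∈ A; rwa [hs])
    change _ ∈ B at this; rwa [hs] at this
  · intro h x hx; exact h hx

theorem maxFace_add (P Q : Set (I → ℝ)) (y : I → ℝ) :
    maxFace (P + Q) y = maxFace P y + maxFace Q y := by
  ext x
  constructor
  · rintro ⟨⟨a, ha, b, hb, rfl⟩, hm⟩
    refine ⟨a, ⟨ha, fun c hc => ?_⟩, b, ⟨hb, fun c hc => ?_⟩, rfl⟩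
    · have := hm (c + b) (Set.add_mem_add hc hb)
      simp only [dotProduct_add] at this; linarith
    · have := hm (a + c) (Set.add_mem_add ha hc)
      simp only [dotProduct_add] at this; linarith
  · rintro ⟨a, ⟨ha, ha'⟩, b, ⟨hb, hb'⟩, rfl⟩
    refine ⟨Set.add_mem_add ha hb, ?_⟩
    rintro _ ⟨c, hc, d, hd, rfl⟩
    simp only [dotProduct_add]
    exact add_le_add (ha' c hc) (hb' d hd)

omit [Fintype ι] in
theorem maxFace_sum (s : Finset ι) (P : ι → Set (I → ℝ)) (y : I → ℝ) :
    maxFace (∑ i ∈ s, P i) y = ∑ i ∈ s, maxFace (P i) y := by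
  classical
  induction s using Finset.induction_on with
  | empty =>
    ext x
    simp only [maxFace, Finset.sum_empty, Set.mem_zero, Set.mem_ofPred_eq, and_iff_left_iff_imp]
    rintro rfl z rfl
    exact le_rfl
  | insert i s hi ih => rw [Finset.sum_insert hi, Finset.sum_insert hi, maxFace_add, ih]

/-! ### Hypergraphic polytopes -/

/-- The elements of `D` at which `y` attains its maximum over `D`. -/
def argmax (D : Set I) (y : I → ℝ) : Set I := {k | k ∈ D ∧ ∀ l ∈ D, y l ≤ y k}

omit [Fintype I] in
theorem argmax_subset (D : Set I) (y : I → ℝ) : argmax D y ⊆ D := fun _ h => h.1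

theorem argmax_nonempty {D : Set I} (hD : D.Nonempty) (y : I → ℝ) : (argmax D y).Nonempty := by
  obtain ⟨k, hk, h⟩ := Set.exists_max_image D y D.toFinite hD
  exact ⟨k, hk, h⟩

open Classical in
/-- The simplex `Δ_D = conv {e_k : k ∈ D}`. -/
def simplex (D : Set I) : Set (I → ℝ) := convexHull ℝ {x | ∃ k ∈ D, x = Pi.single k 1}

theorem mem_simplex_iff {D : Set I} {x : I → ℝ} :
    x ∈ simplex D ↔ (∀ k, 0 ≤ x k) ∧ ∑ k, x k = 1 ∧ ∀ k ∉ D, x k = 0 := by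
  classical
  constructor
  · intro hx
    have hc : Convex ℝ {x : I → ℝ | (∀ k, 0 ≤ x k) ∧ ∑ k, x k = 1 ∧ ∀ k ∉ D, x k = 0} := by
      rintro x ⟨hx1, hx2, hx3⟩ z ⟨hz1, hz2, hz3⟩ a b ha hb hab
      refine ⟨fun k => ?_, ?_, fun k hk => ?_⟩
      · have := hx1 k; have := hz1 k
        simp only [Pi.add_apply, Pi.smul_apply, smul_eq_mul]; positivity
      · simp only [Pi.add_apply, Pi.smul_apply, smul_eq_mul, Finset.sum_add_distrib,
          ← Finset.mul_sum, hx2, hz2]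
        linarith
      · simp [hx3 k hk, hz3 k hk]
    refine convexHull_min ?_ hc hx
    rintro _ ⟨k, hk, rfl⟩
    refine ⟨fun l => ?_, by simp, fun l hl => ?_⟩
    · by_cases h : l = k
      · subst h; simp
      · simp [h]
    · have : l ≠ k := fun h => hl (h ▸ hk)
      simp [this]
  · rintro ⟨h1, h2, h3⟩
    have hx : x = ∑ k ∈ Finset.univ.filter (· ∈ D), x k • (Pi.single k 1 : I → ℝ) := by
      rw [Finset.sum_filter_of_ne]
      · funext l; simp [Finset.sum_apply, Pi.single_apply]
      · intro k _ hk
        by_contra hD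
        exact hk (by simp [h3 k hD])
    rw [hx]
    refine (convex_convexHull ℝ _).sum_mem (fun k _ => h1 k) ?_ ?_
    · rw [Finset.sum_filter_of_ne, h2]
      intro k _ hk
      by_contra hD
      exact hk (h3 k hD)
    · intro k hk
      exact subset_convexHull ℝ _ ⟨k, (Finset.mem_filter.1 hk).2, rfl⟩

omit [Fintype I] in
open Classical in
theorem single_mem_simplex {D : Set I} {k : I} (hk : k ∈ D) :
    (Pi.single k 1 : I → ℝ) ∈ simplex D := subset_convexHull ℝ _ ⟨k, hk, rfl⟩

omit [Fintype I] in
theorem simplex_mono {D E : Set I} (h : D ⊆ E) : simplex D ⊆ simplex E :=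
  convexHull_mono fun _ ⟨k, hk, e⟩ => ⟨k, h hk, e⟩

theorem maxFace_simplex {D : Set I} (hD : D.Nonempty) (y : I → ℝ) :
    maxFace (simplex D) y = simplex (argmax D y) := by
  classical
  obtain ⟨m, hm, hmax⟩ := argmax_nonempty hD y
  have hle : ∀ x ∈ simplex D, ∀ k, y k * x k ≤ y m * x k := by
    intro x hx k
    obtain ⟨h1, -, h3⟩ := mem_simplex_iff.1 hx
    by_cases hk : k ∈ D
    · exact mul_le_mul_of_nonneg_right (hmax k hk) (h1 k)
    · simp [h3 k hk]
  have hsum : ∀ x ∈ simplex D, ∑ k, y m * x k = y m := by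
    intro x hx
    rw [← Finset.mul_sum, (mem_simplex_iff.1 hx).2.1, mul_one]
  ext x
  constructor
  · rintro ⟨hx, hx'⟩
    have hge : y m ≤ ∑ k, y k * x k := by
      have := hx' _ (single_mem_simplex hm)
      rwa [dotProduct_single, mul_one] at this
    have heq := (Finset.sum_eq_sum_iff_of_le fun k _ => hle x hx k).1
      (le_antisymm (Finset.sum_le_sum fun k _ => hle x hx k) (by rw [hsum x hx]; exact hge))
    obtain ⟨h1, h2, h3⟩ := mem_simplex_iff.1 hx
    refine mem_simplex_iff.2 ⟨h1, h2, fun k hk => ?_⟩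
    by_cases hkD : k ∈ D
    · by_contra h0
      refine hk ⟨hkD, fun l hl => ?_⟩
      rw [mul_right_cancel₀ h0 (heq k (Finset.mem_univ _))]
      exact hmax l hl
    · exact h3 k hkD
  · intro hx
    have hxD := simplex_mono (argmax_subset D y) hx
    refine ⟨hxD, fun z hz => ?_⟩
    have h1 : y ⬝ᵥ x = y m := by
      rw [← hsum x hxD]
      refine Finset.sum_congr rfl fun k _ => ?_
      by_cases hk : k ∈ argmax D y
      · rw [le_antisymm (hmax k hk.1) (hk.2 m hm)]
      · simp [(mem_simplex_iff.1 hx).2.2 k hk]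
    rw [h1, ← hsum z hz]
    exact Finset.sum_le_sum fun k _ => hle z hz k

/-- The hypergraphic polytope `∑ᵢ Δ_{D i}` (Minkowski sum) of a family of sets `D i ⊆ I`. -/
def hypergraphic (D : ι → Set I) : Set (I → ℝ) := ∑ i, simplex (D i)

omit [Fintype I] in
theorem hypergraphic_nonempty {D : ι → Set I} (hD : ∀ i, (D i).Nonempty) :
    (hypergraphic D).Nonempty :=
  Finset.sum_induction _ Set.Nonempty (fun _ _ => Set.Nonempty.add) (Set.singleton_nonempty _)
    fun i _ => (hD i).elim fun _ hk => ⟨_, single_mem_simplex hk⟩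

theorem maxFace_hypergraphic {D : ι → Set I} (hD : ∀ i, (D i).Nonempty) (y : I → ℝ) :
    maxFace (hypergraphic D) y = hypergraphic fun i => argmax (D i) y := by
  unfold hypergraphic
  rw [maxFace_sum]
  exact Finset.sum_congr rfl fun i _ => maxFace_simplex (hD i) y

omit [Fintype I] in
theorem hypergraphic_comp_equiv (e : κ ≃ ι) (D : ι → Set I) :
    hypergraphic (fun k => D (e k)) = hypergraphic D :=
  Equiv.sum_comp e fun i => simplex (D i)

theorem maxFace_hypergraphic_nonempty {D : ι → Set I} (hD : ∀ i, (D i).Nonempty) (y : I → ℝ) :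
    (maxFace (hypergraphic D) y).Nonempty := by
  rw [maxFace_hypergraphic hD]
  exact hypergraphic_nonempty fun i => argmax_nonempty (hD i) y

/-- Each member of the family maximises `w` wherever it maximises `y`. For the normal fan of the
hypergraphic polytope of the family, this says that `w` lies in every cone that contains `y`. -/
def ArgmaxLE (F : Set (Set I)) (y w : I → ℝ) : Prop := ∀ A ∈ F, argmax A y ⊆ argmax A w

theorem maxFace_hypergraphic_subset_iff {D : ι → Set I} (hD : ∀ i, (D i).Nonempty)
    (y w : I → ℝ) : maxFace (hypergraphic D) y ⊆ maxFace (hypergraphic D) w ↔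
      ArgmaxLE (Set.range D) y w := by
  classical
  constructor
  · rintro h _ ⟨i, rfl⟩ k hk
    refine ⟨hk.1, fun l hl => ?_⟩
    choose m hm using fun i => argmax_nonempty (hD i) y
    -- The point `∑ e_{m j}` with `m i` replaced by `k` is a `w`-maximal vertex; it is compared with
    -- the point where `m i` is replaced by `l`.
    have hmem : ∀ a ∈ D i, ∑ j, (Pi.single (Function.update m i a j) 1 : I → ℝ) ∈
        hypergraphic D := fun a ha => by
      refine Set.finsetSum_mem_finsetSum _ _ _ fun j _ => single_mem_simplex ?_
      by_cases hj : j = i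
      · subst hj; simpa using ha
      · simpa [hj] using (hm j).1
    have hk' : ∑ j, (Pi.single (Function.update m i k j) 1 : I → ℝ) ∈
        maxFace (hypergraphic D) y := by
      rw [maxFace_hypergraphic hD]
      refine Set.finsetSum_mem_finsetSum _ _ _ fun j _ => single_mem_simplex ?_
      by_cases hj : j = i
      · subst hj; simpa using hk
      · simpa [hj] using hm j
    have := (h hk').2 _ (hmem l hl)
    have hdot : ∀ a, w ⬝ᵥ ∑ j, (Pi.single (Function.update m i a j) 1 : I → ℝ) =
        w a + ∑ j ∈ Finset.univ.erase i, w (m j) := by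
      intro a
      rw [dotProduct_sum, ← Finset.add_sum_erase _ _ (Finset.mem_univ i)]
      congr 1
      · simp
      · refine Finset.sum_congr rfl fun j hj => ?_
        simp [Finset.ne_of_mem_erase hj]
    rw [hdot, hdot] at this
    linarith
  · intro h
    rw [maxFace_hypergraphic hD, maxFace_hypergraphic hD]
    exact Set.finsetSum_subset_finsetSum _ _ _ fun i _ => simplex_mono (h _ ⟨i, rfl⟩)

omit [Fintype I] in
/-- The face of a face: for a `0/1`-valued functional `v` and large `N`, the `y`-maximal face of
the `v`-maximal face is the `(N v + y)`-maximal face. -/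
theorem argmax_argmax {D : Set I} {v y : I → ℝ} {N : ℝ} (hv : ∀ i, v i = 0 ∨ v i = 1)
    (hN : ∀ i j, y i - y j < N) : argmax (argmax D v) y = argmax D (fun i => N * v i + y i) := by
  have hlt : ∀ i j, v i < v j → N * v i + y i < N * v j + y j := by
    intro i j h
    have := hN i j
    rcases hv i with hi | hi <;> rcases hv j with hj | hj <;> rw [hi, hj] at h ⊢ <;> linarith
  ext k
  constructor
  · rintro ⟨⟨hk, hkv⟩, hky⟩
    refine ⟨hk, fun l hl => ?_⟩
    rcases (hkv l hl).lt_or_eq with h | h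
    · exact (hlt l k h).le
    · have := hky l ⟨hl, fun a ha => h ▸ hkv a ha⟩
      simp only [h]; linarith
  · rintro ⟨hk, hmax⟩
    have hkv : ∀ l ∈ D, v l ≤ v k := fun l hl => by
      by_contra h
      exact absurd (hmax l hl) (not_le.2 (hlt k l (not_le.1 h)))
    refine ⟨⟨hk, hkv⟩, fun l hl => ?_⟩
    have h1 := hmax l hl.1
    have h2 : v l = v k := le_antisymm (hkv l hl.1) (hl.2 k hk)
    simp only [h2] at h1; linarith

omit [Fintype I] in
theorem exists_gt_sub [Finite I] (y w : I → ℝ) :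
    ∃ N : ℝ, (∀ i j, y i - y j < N) ∧ ∀ i j, w i - w j < N := by
  obtain ⟨M, hM⟩ := (Set.finite_range fun p : I × I =>
    max (y p.1 - y p.2) (w p.1 - w p.2)).bddAbove
  refine ⟨M + 1, fun i j => ?_, fun i j => ?_⟩
  · have := hM ⟨(i, j), rfl⟩
    have := le_max_left (y i - y j) (w i - w j)
    simp only at *; linarith
  · have := hM ⟨(i, j), rfl⟩
    have := le_max_right (y i - y j) (w i - w j)
    simp only at *; linarith

/-- The normal fan of a hypergraphic polytope determines the normal fans of its faces. -/
theorem normalFan_maxFace_eq {D : ι → Set I} {E : κ → Set I} (hD : ∀ i, (D i).Nonempty)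
    (hE : ∀ i, (E i).Nonempty) (h : normalFan (hypergraphic D) = normalFan (hypergraphic E))
    {v : I → ℝ} (hv : ∀ i, v i = 0 ∨ v i = 1) :
    normalFan (maxFace (hypergraphic D) v) = normalFan (maxFace (hypergraphic E) v) := by
  rw [normalFan_eq_iff] at h ⊢
  intro y w
  obtain ⟨N, hy, hw⟩ := exists_gt_sub y w
  have := h (fun i => N * v i + y i) (fun i => N * v i + w i)
  rw [maxFace_hypergraphic hD, maxFace_hypergraphic hD, maxFace_hypergraphic hE,
    maxFace_hypergraphic hE] at this
  rw [maxFace_hypergraphic hD, maxFace_hypergraphic hE,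
    maxFace_hypergraphic (fun i => argmax_nonempty (hD i) v),
    maxFace_hypergraphic (fun i => argmax_nonempty (hD i) v),
    maxFace_hypergraphic (fun i => argmax_nonempty (hE i) v),
    maxFace_hypergraphic (fun i => argmax_nonempty (hE i) v)]
  simpa only [argmax_argmax hv hy, argmax_argmax hv hw] using this

omit [Fintype I] in
theorem extendByZero_image_simplex {φ : J → I} (hφ : Function.Injective φ) (D : Set J) :
    Function.ExtendByZero.linearMap ℝ φ '' simplex D = simplex (φ '' D) := by
  classical
  have hsing : ∀ k, Function.ExtendByZero.linearMap ℝ φ (Pi.single k 1) =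
      (Pi.single (φ k) 1 : I → ℝ) := by
    intro k
    funext i
    rw [Function.ExtendByZero.linearMap_apply]
    by_cases hi : ∃ j, φ j = i
    · obtain ⟨j, rfl⟩ := hi
      rw [hφ.extend_apply]
      simp [Pi.single_apply, hφ.eq_iff]
    · rw [Function.extend_apply' _ _ _ hi, Pi.single_eq_of_ne (fun h => hi ⟨k, h.symm⟩)]; rfl
  unfold simplex
  rw [LinearMap.image_convexHull]
  congr 1
  ext x
  constructor
  · rintro ⟨_, ⟨k, hk, rfl⟩, rfl⟩
    exact ⟨φ k, ⟨k, hk, rfl⟩, by rw [hsing]⟩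
  · rintro ⟨_, ⟨k, hk, rfl⟩, rfl⟩
    exact ⟨_, ⟨k, hk, rfl⟩, by rw [hsing]⟩

omit [Fintype I] in
theorem extendByZero_image_hypergraphic {φ : J → I} (hφ : Function.Injective φ) (D : ι → Set J) :
    Function.ExtendByZero.linearMap ℝ φ '' hypergraphic D = hypergraphic fun i => φ '' D i := by
  unfold hypergraphic
  rw [Set.image_finsetSum]
  exact Finset.sum_congr rfl fun i _ => extendByZero_image_simplex hφ (D i)

theorem prodSet_hypergraphic (D : ι → Set S) (E : κ → Set T) :
    prodSet (hypergraphic D) (hypergraphic E) = hypergraphic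
      (Sum.elim (fun i => Sum.inl '' D i) (fun i => Sum.inr '' E i) : ι ⊕ κ → Set (S ⊕ T)) := by
  have h : ∀ (P : Set (S → ℝ)) (Q : Set (T → ℝ)), prodSet P Q =
      Function.ExtendByZero.linearMap ℝ (Sum.inl : S → S ⊕ T) '' P +
        Function.ExtendByZero.linearMap ℝ (Sum.inr : T → S ⊕ T) '' Q := by
    intro P Q
    have hl : ∀ (p : S → ℝ) (q : T → ℝ),
        Function.ExtendByZero.linearMap ℝ (Sum.inl : S → S ⊕ T) p +
        Function.ExtendByZero.linearMap ℝ (Sum.inr : T → S ⊕ T) q = Sum.elim p q := by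
      intro p q
      funext i
      rcases i with i | i
      · simp [Function.ExtendByZero.linearMap_apply, Sum.inl_injective.extend_apply,
          Function.extend_apply']
      · simp [Function.ExtendByZero.linearMap_apply, Sum.inr_injective.extend_apply,
          Function.extend_apply']
    ext x
    constructor
    · rintro ⟨hp, hq⟩
      refine ⟨_, ⟨_, hp, rfl⟩, _, ⟨_, hq, rfl⟩, ?_⟩
      simp only [hl]
      exact Sum.elim_comp_inl_inr x
    · rintro ⟨_, ⟨p, hp, rfl⟩, _, ⟨q, hq, rfl⟩, rfl⟩
      simp only [hl]
      exact ⟨by simpa using hp, by simpa using hq⟩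
  rw [h, extendByZero_image_hypergraphic Sum.inl_injective,
    extendByZero_image_hypergraphic Sum.inr_injective]
  unfold hypergraphic
  rw [Fintype.sum_sum_type]
  rfl

end Polytopes

/-! ### Block intervals -/

section Blocks

variable {I J S T ι α β : Type}

/-- The interval from `i` to `j` inside the block of `i`, where `f` labels the blocks and `r` ranks
the elements inside each block. -/
def blockInterval (f : I → α) (r : I → ℕ) (i j : I) : Set I :=
  {k | f k = f i ∧ r i ≤ r k ∧ r k ≤ r j}

/-- All nonempty intervals inside blocks. -/
def blockIntervals (f : I → α) (r : I → ℕ) : Set (Set I) :=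
  {A | ∃ i j, f i = f j ∧ r i ≤ r j ∧ A = blockInterval f r i j}

theorem nonempty_of_mem_blockIntervals {f : I → α} {r : I → ℕ} {A : Set I}
    (h : A ∈ blockIntervals f r) : A.Nonempty := by
  obtain ⟨i, j, -, hr, rfl⟩ := h
  exact ⟨i, rfl, le_rfl, hr⟩

theorem blockIntervals_congr {f : I → α} {r : I → ℕ} {f' : I → β} {r' : I → ℕ}
    (hf : ∀ i j, f i = f j ↔ f' i = f' j) (hr : ∀ i j, f i = f j → (r i ≤ r j ↔ r' i ≤ r' j)) :
    blockIntervals f r = blockIntervals f' r' := by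
  have hI : ∀ i j, f i = f j → blockInterval f r i j = blockInterval f' r' i j := by
    intro i j hij
    ext k
    constructor
    · rintro ⟨h1, h2, h3⟩
      exact ⟨(hf _ _).1 h1, (hr _ _ h1.symm).1 h2, (hr _ _ (h1.trans hij)).1 h3⟩
    · rintro ⟨h1, h2, h3⟩
      have h1 := (hf _ _).2 h1
      exact ⟨h1, (hr _ _ h1.symm).2 h2, (hr _ _ (h1.trans hij)).2 h3⟩
  ext A
  constructor
  · rintro ⟨i, j, h, hle, rfl⟩
    exact ⟨i, j, (hf _ _).1 h, (hr _ _ h).1 hle, hI i j h⟩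
  · rintro ⟨i, j, h, hle, rfl⟩
    have h := (hf _ _).2 h
    exact ⟨i, j, h, (hr _ _ h).2 hle, (hI i j h).symm⟩

theorem argmax_image (φ : J → I) (A : Set J) (y : I → ℝ) :
    argmax (φ '' A) y = φ '' argmax A (y ∘ φ) := by
  ext k
  constructor
  · rintro ⟨⟨a, ha, rfl⟩, h⟩
    exact ⟨a, ⟨ha, fun l hl => h _ ⟨l, hl, rfl⟩⟩, rfl⟩
  · rintro ⟨a, ⟨ha, h⟩, rfl⟩
    refine ⟨⟨a, ha, rfl⟩, ?_⟩
    rintro _ ⟨l, hl, rfl⟩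
    exact h l hl

theorem argmaxLE_image {φ : J → I} (hφ : Function.Injective φ) (F : Set (Set J)) (y w : I → ℝ) :
    ArgmaxLE ((fun A => φ '' A) '' F) y w ↔ ArgmaxLE F (y ∘ φ) (w ∘ φ) := by
  unfold ArgmaxLE
  rw [Set.forall_mem_image]
  refine forall₂_congr fun A _ => ?_
  rw [argmax_image, argmax_image, Set.image_subset_image_iff hφ]

theorem argmaxLE_union (F G : Set (Set I)) (y w : I → ℝ) :
    ArgmaxLE (F ∪ G) y w ↔ ArgmaxLE F y w ∧ ArgmaxLE G y w := by
  unfold ArgmaxLE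
  simp only [Set.mem_union, or_imp, forall_and]

theorem image_blockIntervals (σ : I ≃ J) (f : J → α) (r : J → ℕ) :
    (fun A => σ '' A) '' blockIntervals (f ∘ σ) (r ∘ σ) = blockIntervals f r := by
  have hI : ∀ i j, σ '' blockInterval (f ∘ σ) (r ∘ σ) i j = blockInterval f r (σ i) (σ j) := by
    intro i j
    rw [σ.image_eq_preimage_symm]
    ext k
    simp [blockInterval]
  ext A
  constructor
  · rintro ⟨_, ⟨i, j, h, hle, rfl⟩, rfl⟩
    exact ⟨σ i, σ j, h, hle, hI i j⟩
  · rintro ⟨i, j, h, hle, rfl⟩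
    refine ⟨_, ⟨σ.symm i, σ.symm j, by simpa using h, by simpa using hle, rfl⟩, ?_⟩
    simp only [hI, σ.apply_symm_apply]

theorem blockIntervals_sum {f : S ⊕ T → α} {r : S ⊕ T → ℕ}
    (hf : ∀ i j, f (Sum.inl i) ≠ f (Sum.inr j)) : blockIntervals f r =
      (fun A => Sum.inl '' A) '' blockIntervals (f ∘ Sum.inl) (r ∘ Sum.inl) ∪
      (fun A => Sum.inr '' A) '' blockIntervals (f ∘ Sum.inr) (r ∘ Sum.inr) := by
  have hl : ∀ i j, Sum.inl '' blockInterval (f ∘ Sum.inl) (r ∘ Sum.inl) i j =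
      blockInterval f r (Sum.inl i) (Sum.inl j) := by
    intro i j
    ext (k | k)
    · simp [blockInterval]
    · simp [blockInterval, (hf i k).symm]
  have hr : ∀ i j, Sum.inr '' blockInterval (f ∘ Sum.inr) (r ∘ Sum.inr) i j =
      blockInterval f r (Sum.inr i) (Sum.inr j) := by
    intro i j
    ext (k | k)
    · simp [blockInterval, hf k i]
    · simp [blockInterval]
  ext A
  constructor
  · rintro ⟨i | i, j | j, h, hle, rfl⟩
    · exact Or.inl ⟨_, ⟨i, j, h, hle, rfl⟩, hl i j⟩
    · exact absurd h (hf _ _)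
    · exact absurd h.symm (hf _ _)
    · exact Or.inr ⟨_, ⟨i, j, h, hle, rfl⟩, hr i j⟩
  · rintro (⟨_, ⟨i, j, h, hle, rfl⟩, rfl⟩ | ⟨_, ⟨i, j, h, hle, rfl⟩, rfl⟩)
    · exact ⟨_, _, h, hle, hl i j⟩
    · exact ⟨_, _, h, hle, hr i j⟩

/-- The intersections of block intervals of `S ⊕ T` with `S` are the block intervals of `S`. -/
theorem preimage_inl_blockIntervals [Finite S] (f : S ⊕ T → α) (r : S ⊕ T → ℕ) :
    {B | ∃ A ∈ blockIntervals f r, (Sum.inl ⁻¹' A).Nonempty ∧ B = Sum.inl ⁻¹' A} =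
      blockIntervals (f ∘ Sum.inl) (r ∘ Sum.inl) := by
  ext B
  constructor
  · rintro ⟨_, ⟨i, j, h, hle, rfl⟩, hne, rfl⟩
    obtain ⟨a, ha, hmin⟩ := Set.exists_min_image _ (r ∘ Sum.inl) (Set.toFinite _) hne
    obtain ⟨c, hc, hmax⟩ := Set.exists_max_image _ (r ∘ Sum.inl) (Set.toFinite _) hne
    refine ⟨a, c, ha.1.trans hc.1.symm, hmin c hc, ?_⟩
    ext k
    constructor
    · intro hk
      exact ⟨hk.1.trans ha.1.symm, hmin k hk, hmax k hk⟩
    · rintro ⟨h1, h2, h3⟩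
      exact ⟨h1.trans ha.1, ha.2.1.trans h2, h3.trans hc.2.2⟩
  · rintro ⟨i, j, h, hle, rfl⟩
    exact ⟨_, ⟨Sum.inl i, Sum.inl j, h, hle, rfl⟩, ⟨i, rfl, le_rfl, hle⟩, rfl⟩

/-- The labels of the blocks of the contraction to `T`: a block of `S ⊕ T` is cut at its elements
in `S`, so two of its elements in `T` stay together exactly if the same elements of `S`
precede them. -/
def cutLabel (f : S ⊕ T → α) (r : S ⊕ T → ℕ) (k : T) : α × Set S :=
  (f (Sum.inr k), {s | f (Sum.inl s) = f (Sum.inr k) ∧ r (Sum.inl s) < r (Sum.inr k)})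

/-- The block intervals of `S ⊕ T` that do not meet `S` are the intervals of the blocks that are
obtained by cutting at the elements of `S`. -/
theorem preimage_inr_blockIntervals {f : S ⊕ T → α} {r : S ⊕ T → ℕ}
    (hfr : ∀ i j, f i = f j → r i = r j → i = j) :
    {B | ∃ A ∈ blockIntervals f r, ¬(Sum.inl ⁻¹' A).Nonempty ∧ B = Sum.inr ⁻¹' A} =
      blockIntervals (cutLabel f r) (r ∘ Sum.inr) := by
  have hcut : ∀ i j : T, f (Sum.inr i) = f (Sum.inr j) → r (Sum.inr i) ≤ r (Sum.inr j) →
      (cutLabel f r i = cutLabel f r j ↔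
        ¬(Sum.inl ⁻¹' blockInterval f r (Sum.inr i) (Sum.inr j)).Nonempty) := by
    intro i j h hle
    constructor
    · rintro hg ⟨s, hs1, hs2, hs3⟩
      have hlt : r (Sum.inl s) < r (Sum.inr j) :=
        lt_of_le_of_ne hs3 fun he => Sum.inl_ne_inr (hfr _ _ (hs1.trans h) he)
      have hmem : s ∈ (cutLabel f r j).2 := ⟨hs1.trans h, hlt⟩
      rw [← hg] at hmem
      exact absurd hmem.2 (not_lt.2 hs2)
    · intro hne
      refine Prod.ext h (Set.ext fun s => ⟨?_, ?_⟩)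
      · rintro ⟨h1, h2⟩
        exact ⟨h1.trans h, h2.trans_le hle⟩
      · rintro ⟨h1, h2⟩
        refine ⟨h1.trans h.symm, ?_⟩
        by_contra hlt
        exact hne ⟨s, h1.trans h.symm, not_lt.1 hlt, h2.le⟩
  have hI : ∀ i j : T, cutLabel f r i = cutLabel f r j → r (Sum.inr i) ≤ r (Sum.inr j) →
      Sum.inr ⁻¹' blockInterval f r (Sum.inr i) (Sum.inr j) =
        blockInterval (cutLabel f r) (r ∘ Sum.inr) i j := by
    intro i j h hle
    have hf : f (Sum.inr i) = f (Sum.inr j) := congrArg Prod.fst h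
    ext k
    constructor
    · rintro ⟨h1, h2, h3⟩
      refine ⟨((hcut i k h1.symm h2).2 ?_).symm, h2, h3⟩
      rintro ⟨s, hs1, hs2, hs3⟩
      exact (hcut i j hf hle).1 h ⟨s, hs1, hs2, hs3.trans h3⟩
    · rintro ⟨h1, h2, h3⟩
      exact ⟨congrArg Prod.fst h1, h2, h3⟩
  ext B
  constructor
  · rintro ⟨_, ⟨i, j, h, hle, rfl⟩, hne, rfl⟩
    rcases i with i | i
    · exact absurd ⟨i, rfl, le_rfl, hle⟩ hne
    rcases j with j | j
    · exact absurd ⟨j, h.symm, hle, le_rfl⟩ hne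
    have hg := (hcut i j h hle).2 hne
    exact ⟨i, j, hg, hle, hI i j hg hle⟩
  · rintro ⟨i, j, h, hle, rfl⟩
    have hf : f (Sum.inr i) = f (Sum.inr j) := congrArg Prod.fst h
    exact ⟨_, ⟨Sum.inr i, Sum.inr j, hf, hle, rfl⟩, (hcut i j hf hle).1 h, (hI i j h hle).symm⟩

/-- Two elements are in the same block exactly if every functional in the lineality space, that is,
in the smallest cone containing `0`, takes the same value at both. -/
theorem forall_argmaxLE_zero_iff {f : I → α} {r : I → ℕ} {i j : I} :
    (∀ y, ArgmaxLE (blockIntervals f r) 0 y → y i = y j) ↔ f i = f j := by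
  classical
  constructor
  · intro h
    -- The indicator function of the block of `i` lies in the lineality space.
    have := h (fun k => if f k = f i then 1 else 0) ?_
    · by_contra hne
      simp [Ne.symm hne] at this
    · rintro _ ⟨a, c, -, -, rfl⟩ k ⟨hk, -⟩
      refine ⟨hk, fun l hl => ?_⟩
      simp only [hl.1, hk.1, le_refl]
  · intro h y hy
    have key : ∀ i j, f i = f j → r i ≤ r j → y i = y j := by
      intro i j h hle
      have hA := hy _ ⟨i, j, h, hle, rfl⟩
      have hi : i ∈ blockInterval f r i j := ⟨rfl, le_rfl, hle⟩
      have hj : j ∈ blockInterval f r i j := ⟨h.symm, hle, le_rfl⟩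
      exact le_antisymm ((hA ⟨hj, fun _ _ => le_rfl⟩).2 i hi)
        ((hA ⟨hi, fun _ _ => le_rfl⟩).2 j hj)
    rcases le_total (r i) (r j) with hle | hle
    · exact key i j h hle
    · exact (key j i h.symm hle).symm

/-! ### Products of associahedra as hypergraphic polytopes -/

/-- `P` is the Minkowski sum of the simplices of all intervals inside the blocks of `f`, each
interval being taken at least once. -/
def IsBlockPolytope (P : Set (I → ℝ)) (f : I → α) (r : I → ℕ) : Prop :=
  ∃ (ι : Type) (_ : Fintype ι) (D : ι → Set I),
    P = hypergraphic D ∧ Set.range D = blockIntervals f r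

theorem isBlockPolytope_loday [Fintype I] (ℓ : LinearOrder I) {r : I → ℕ}
    (hr : ∀ i j, r i ≤ r j ↔ ℓ.le i j) : IsBlockPolytope (loday ℓ) (fun _ => ()) r := by
  classical
  refine ⟨{p : I × I // ℓ.le p.1 p.2}, inferInstance,
    fun p => {k | ℓ.le p.1.1 k ∧ ℓ.le k p.1.2}, ?_, ?_⟩
  · unfold loday hypergraphic
    rw [Finset.sum_subtype (p := fun p : I × I => ℓ.le p.1 p.2) _ (by simp)]
    refine Finset.sum_congr rfl fun p _ => ?_
    unfold simplex
    simp only [Set.mem_ofPred_eq, and_assoc]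
    congr!
  · ext A
    constructor
    · rintro ⟨⟨⟨i, j⟩, h⟩, rfl⟩
      refine ⟨i, j, rfl, (hr i j).2 h, ?_⟩
      ext k
      simp [blockInterval, hr]
    · rintro ⟨i, j, -, h, rfl⟩
      refine ⟨⟨⟨i, j⟩, (hr i j).1 h⟩, ?_⟩
      ext k
      simp [blockInterval, hr]

theorem isBlockPolytope_lodayProduct [Fintype I] (b : I → I) (ℓ : ∀ j, LinearOrder {i // b i = j})
    {r : I → ℕ} (hr : ∀ j (a c : {i // b i = j}), r a ≤ r c ↔ (ℓ j).le a c) :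
    IsBlockPolytope (lodayProduct b ℓ) b r := by
  classical
  choose ι hι D hP hD using fun j =>
    @isBlockPolytope_loday _ (Fintype.ofFinite _) (ℓ j) (fun a => r a) (hr j)
  refine ⟨Σ j, ι j, inferInstance, fun q => Subtype.val '' D q.1 q.2, ?_, ?_⟩
  · have hsum : hypergraphic (fun q : Σ j, ι j => (Subtype.val '' D q.1 q.2 : Set I)) =
        ∑ j, Function.ExtendByZero.linearMap ℝ (Subtype.val : {i // b i = j} → I) ''
          hypergraphic (D j) := by
      simp only [extendByZero_image_hypergraphic Subtype.val_injective]
      unfold hypergraphic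
      rw [Fintype.sum_sigma]
    have hglue : ∀ x : ∀ j, {i // b i = j} → ℝ,
        ∑ j, Function.ExtendByZero.linearMap ℝ (Subtype.val : {i // b i = j} → I) (x j) =
          fun i => x (b i) ⟨i, rfl⟩ := by
      intro x
      funext i
      rw [Finset.sum_apply, Finset.sum_eq_single (b i)]
      · rw [Function.ExtendByZero.linearMap_apply]
        exact Subtype.val_injective.extend_apply (x (b i)) 0 (⟨i, rfl⟩ : {k // b k = b i})
      · intro j _ hj
        rw [Function.ExtendByZero.linearMap_apply, Function.extend_apply']
        · rfl
        · rintro ⟨⟨k, hk⟩, rfl⟩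
          exact hj hk.symm
      · simp
    rw [hsum, lodayProduct_eq_image]
    ext x
    rw [Set.mem_finsetSum]
    constructor
    · rintro ⟨y, hy, rfl⟩
      refine ⟨fun j => _, fun {j} _ => ⟨y j, ?_, rfl⟩, hglue y⟩
      rw [← hP]; exact hy j trivial
    · rintro ⟨g, hg, rfl⟩
      choose y hy hyg using fun j => hg (Finset.mem_univ j)
      refine ⟨y, fun j _ => ?_, ?_⟩
      · exact (hP j).ge (hy j)
      · simp only [← hyg, hglue]
  · ext A
    constructor
    · rintro ⟨⟨j, q⟩, rfl⟩
      have hq := (hD j).le ⟨q, rfl⟩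
      obtain ⟨⟨a, rfl⟩, ⟨c, hc⟩, -, hle, he⟩ := hq
      refine ⟨a, c, hc.symm, hle, ?_⟩
      ext k
      simp [he, blockInterval]
      tauto
    · rintro ⟨i, j, h, hle, rfl⟩
      have : blockInterval (fun _ => ()) (fun a : {k // b k = b i} => r a) ⟨i, rfl⟩ ⟨j, h.symm⟩ ∈
          Set.range (D (b i)) := by
        rw [hD]
        exact ⟨_, _, rfl, hle, rfl⟩
      obtain ⟨q, hq⟩ := this
      refine ⟨⟨b i, q⟩, ?_⟩
      ext k
      simp [hq, blockInterval]
      tauto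

theorem IsAssocProduct.exists_isBlockPolytope [Fintype I] {P : Set (I → ℝ)}
    (h : IsAssocProduct P) : ∃ (f : I → I) (r : I → ℕ),
      (∀ i j, f i = f j → r i = r j → i = j) ∧ IsBlockPolytope P f r := by
  obtain ⟨b, ℓ, rfl⟩ := h
  -- The rank of an element is the number of elements of its block that are at most equal to it.
  let ρ : ∀ j, {i // b i = j} → ℕ := fun j a => {k : {i // b i = j} | (ℓ j).le k a}.ncard
  have hρ : ∀ j (a c : {i // b i = j}), ρ j a ≤ ρ j c ↔ (ℓ j).le a c := by
    intro j a c
    let _ := ℓ j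
    constructor
    · intro h
      by_contra hac
      refine absurd h (not_le.2 (Set.ncard_lt_ncard ⟨fun k hk => ?_, fun hs => ?_⟩))
      · exact le_trans (show k ≤ c from hk) (not_le.1 hac).le
      · exact hac (hs (show a ≤ a from le_rfl))
    · intro h
      exact Set.ncard_le_ncard fun k hk => le_trans (show k ≤ a from hk) h
  have hr : ∀ j (a : {i // b i = j}), ρ (b a) ⟨a, rfl⟩ = ρ j a := by
    rintro j ⟨a, rfl⟩
    rfl
  have hle : ∀ j (a c : {i // b i = j}),
      ρ (b a) ⟨a, rfl⟩ ≤ ρ (b c) ⟨c, rfl⟩ ↔ (ℓ j).le a c := by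
    intro j a c
    rw [hr, hr, hρ]
  refine ⟨b, fun i => ρ (b i) ⟨i, rfl⟩, fun i j hf he => ?_, isBlockPolytope_lodayProduct b ℓ hle⟩
  have h1 := (hle (b j) ⟨i, hf⟩ ⟨j, rfl⟩).1 (le_of_eq he)
  have h2 := (hle (b j) ⟨j, rfl⟩ ⟨i, hf⟩).1 (le_of_eq he.symm)
  exact congrArg Subtype.val ((ℓ (b j)).le_antisymm _ _ h1 h2)

theorem exists_isAssocProduct_isBlockPolytope [Fintype I] {f : I → α} {r : I → ℕ}
    (hfr : ∀ i j, f i = f j → r i = r j → i = j) :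
    ∃ P : Set (I → ℝ), IsAssocProduct P ∧ IsBlockPolytope P f r := by
  classical
  have hex : ∀ i, ∃ k, f k = f i := fun i => ⟨i, rfl⟩
  -- Blocks are indexed by `I` itself: the block of `i` is named by a chosen representative.
  let b : I → I := fun i => (hex i).choose
  have hb : ∀ i j, b i = b j ↔ f i = f j := by
    intro i j
    constructor
    · intro h
      rw [← (hex i).choose_spec, ← (hex j).choose_spec]
      exact congrArg f h
    · intro h
      simp only [b, h]
  let ℓ : ∀ j, LinearOrder {i // b i = j} := fun j =>
    LinearOrder.lift' (fun a => r a) fun a c hac =>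
      Subtype.ext (hfr _ _ ((hb _ _).1 (a.2.trans c.2.symm)) hac)
  obtain ⟨ι, _, D, hP, hD⟩ := isBlockPolytope_lodayProduct b ℓ (r := r) fun j a c => Iff.rfl
  exact ⟨_, ⟨b, ℓ, rfl⟩, ι, _, D, hP, hD.trans (blockIntervals_congr hb fun _ _ _ => Iff.rfl)⟩

end Blocks

/-! ### The blocks of a class -/

section Classes

variable {I J S T α β : Type} [Fintype I] [Fintype J] [Fintype S] [Fintype T]

theorem AssocClass.fan_injective : Function.Injective (AssocClass.fan (I := I)) := by
  intro z z'
  induction z, z' using Quotient.inductionOn₂ with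
  | h P Q => exact fun h => Quotient.sound h

theorem IsBlockPolytope.maxFace_subset_iff {P : Set (I → ℝ)} {f : I → α} {r : I → ℕ}
    (h : IsBlockPolytope P f r) (y w : I → ℝ) :
    maxFace P y ⊆ maxFace P w ↔ ArgmaxLE (blockIntervals f r) y w := by
  obtain ⟨ι, _, D, rfl, hD⟩ := h
  rw [maxFace_hypergraphic_subset_iff, hD]
  exact fun i => nonempty_of_mem_blockIntervals (hD.le ⟨i, rfl⟩)

/-- The class `z` is represented by the products of associahedra with blocks the fibres of `f`,
each of them ordered by `r`. The labels and ranks of a class are not unique: a normal fan does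
not see the names of the blocks, and reversing the order of a block does not change it. -/
structure HasBlocks (z : AssocClass I) (f : I → α) (r : I → ℕ) : Prop where
  inj : ∀ i j, f i = f j → r i = r j → i = j
  rel : ∀ y w, (∀ C ∈ z.fan, y ∈ C → w ∈ C) ↔ ArgmaxLE (blockIntervals f r) y w

theorem hasBlocks_mk {P : Set (I → ℝ)} (hP : IsAssocProduct P) {f : I → α} {r : I → ℕ}
    (hfr : ∀ i j, f i = f j → r i = r j → i = j) (h : IsBlockPolytope P f r) :
    HasBlocks (AssocClass.mk P hP) f r where
  inj := hfr
  rel y w := (forall_mem_normalFan_iff P y w).trans (h.maxFace_subset_iff y w)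

theorem exists_hasBlocks (z : AssocClass I) : ∃ (f : I → I) (r : I → ℕ), HasBlocks z f r := by
  induction z using Quotient.inductionOn with
  | h P =>
    obtain ⟨P, hP⟩ := P
    obtain ⟨f, r, hfr, h⟩ := hP.exists_isBlockPolytope
    exact ⟨f, r, hasBlocks_mk hP hfr h⟩

theorem exists_class_hasBlocks {f : I → α} {r : I → ℕ}
    (hfr : ∀ i j, f i = f j → r i = r j → i = j) : ∃ z : AssocClass I, HasBlocks z f r := by
  obtain ⟨P, hP, h⟩ := exists_isAssocProduct_isBlockPolytope hfr
  exact ⟨_, hasBlocks_mk hP hfr h⟩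

namespace HasBlocks

variable {z z' : AssocClass I} {f : I → α} {r : I → ℕ} {f' : I → β} {r' : I → ℕ}

theorem maxFace_subset_iff {P : Set (I → ℝ)} {hP : IsAssocProduct P}
    (h : HasBlocks (AssocClass.mk P hP) f r) (y w : I → ℝ) :
    maxFace P y ⊆ maxFace P w ↔ ArgmaxLE (blockIntervals f r) y w :=
  (forall_mem_normalFan_iff P y w).symm.trans (h.rel y w)

theorem fan_eq (h : HasBlocks z f r) {P : Set (I → ℝ)} (hP : IsBlockPolytope P f r) :
    normalFan P = z.fan := by
  induction z using Quotient.inductionOn with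
  | h Q =>
    obtain ⟨Q, hQ⟩ := Q
    refine normalFan_eq_iff.2 fun y w => ?_
    rw [hP.maxFace_subset_iff, HasBlocks.maxFace_subset_iff (hP := hQ) h]

/-- A class is determined by its blocks and their orders. -/
theorem unique (h : HasBlocks z f r) (h' : HasBlocks z' f r) : z = z' := by
  obtain ⟨P, -, hP⟩ := exists_isAssocProduct_isBlockPolytope h.inj
  exact AssocClass.fan_injective ((h.fan_eq hP).symm.trans (h'.fan_eq hP))

theorem congr (h : HasBlocks z f r) (hf : ∀ i j, f i = f j ↔ f' i = f' j)
    (hr : ∀ i j, f i = f j → (r i ≤ r j ↔ r' i ≤ r' j)) : HasBlocks z f' r' where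
  inj i j h1 h2 := by
    have h1 := (hf i j).2 h1
    exact h.inj i j h1 (le_antisymm ((hr i j h1).2 h2.le) ((hr j i h1.symm).2 h2.ge))
  rel y w := by rw [h.rel, blockIntervals_congr hf hr]

/-- The partition into blocks can be recovered from the lineality space of the normal fan. -/
theorem label_eq_iff (h : HasBlocks z f r) (h' : HasBlocks z f' r') (i j : I) :
    f i = f j ↔ f' i = f' j := by
  rw [← forall_argmaxLE_zero_iff (f := f) (r := r), ← forall_argmaxLE_zero_iff (f := f') (r := r')]
  simp only [← h.rel, ← h'.rel]

theorem relabel {g : J → α} {q : J → ℕ} (σ : I ≃ J) (h : HasBlocks z (g ∘ σ) (q ∘ σ)) :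
    HasBlocks (z.relabel σ) g q where
  inj i j h1 h2 := by
    have := h.inj (σ.symm i) (σ.symm j) (by simpa using h1) (by simpa using h2)
    simpa using this
  rel y w := by
    induction z using Quotient.inductionOn with
    | h P =>
      obtain ⟨P, hP⟩ := P
      refine (forall_mem_normalFan_iff (relabelSet σ P) y w).trans ?_
      rw [maxFace_relabelSet, maxFace_relabelSet, relabelSet_subset_relabelSet_iff,
        HasBlocks.maxFace_subset_iff (hP := hP) h, ← argmaxLE_image σ.injective,
        image_blockIntervals]

theorem relabel_symm (h : HasBlocks z f r) (σ : I ≃ J) :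
    HasBlocks (z.relabel σ) (f ∘ σ.symm) (r ∘ σ.symm) := by
  refine HasBlocks.relabel σ ?_
  rw [Function.comp_assoc, Function.comp_assoc, σ.symm_comp_self]
  exact h

theorem prod {x : AssocClass S} {y : AssocClass T} {f : S ⊕ T → α} {r : S ⊕ T → ℕ}
    (hx : HasBlocks x (f ∘ Sum.inl) (r ∘ Sum.inl)) (hy : HasBlocks y (f ∘ Sum.inr) (r ∘ Sum.inr))
    (hf : ∀ i j, f (Sum.inl i) ≠ f (Sum.inr j)) : HasBlocks (x.prod y) f r where
  inj := by
    rintro (i | i) (j | j) h1 h2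
    · exact congrArg _ (hx.inj i j h1 h2)
    · exact absurd h1 (hf i j)
    · exact absurd h1.symm (hf j i)
    · exact congrArg _ (hy.inj i j h1 h2)
  rel u w := by
    induction x, y using Quotient.inductionOn₂ with
    | h P Q =>
      obtain ⟨P, hP⟩ := P
      obtain ⟨Q, hQ⟩ := Q
      refine (forall_mem_normalFan_iff (prodSet P Q) u w).trans ?_
      rw [maxFace_prodSet, maxFace_prodSet,
        prodSet_subset_prodSet_iff (hP.maxFace_nonempty _) (hQ.maxFace_nonempty _),
        HasBlocks.maxFace_subset_iff (hP := hP) hx, HasBlocks.maxFace_subset_iff (hP := hQ) hy,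
        blockIntervals_sum hf, argmaxLE_union, argmaxLE_image Sum.inl_injective,
        argmaxLE_image Sum.inr_injective]

end HasBlocks

theorem hasBlocks_stdAssoc (n : ℕ) :
    HasBlocks (stdAssoc n) (fun _ => ()) (Fin.val : Fin n → ℕ) :=
  hasBlocks_mk _ (fun _ _ _ h => Fin.ext h) (isBlockPolytope_loday _ fun _ _ => Iff.rfl)

/-! ### The coproduct of a class -/

/-- The indicator functional of `S`, whose maximal faces define the coproduct. -/
abbrev indicatorLeft (S T : Type) : S ⊕ T → ℝ := Sum.elim (fun _ => 1) (fun _ => 0)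

omit [Fintype S] [Fintype T] in
theorem argmax_indicatorLeft_of_nonempty {A : Set (S ⊕ T)} (h : (Sum.inl ⁻¹' A).Nonempty) :
    argmax A (indicatorLeft S T) = Sum.inl '' (Sum.inl ⁻¹' A) := by
  obtain ⟨s, hs⟩ := h
  ext (k | k)
  · simp only [argmax, Set.mem_ofPred_eq, Set.mem_image, Set.mem_preimage, Sum.inl.injEq,
      exists_eq_right, and_iff_left_iff_imp]
    rintro - (l | l) - <;> simp
  · simp only [Set.mem_image, reduceCtorEq, and_false, exists_false, iff_false]
    intro hk
    have := hk.2 _ hs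
    simp only [Sum.elim_inl, Sum.elim_inr] at this
    linarith

omit [Fintype S] [Fintype T] in
theorem argmax_indicatorLeft_of_not_nonempty {A : Set (S ⊕ T)}
    (h : ¬(Sum.inl ⁻¹' A).Nonempty) :
    argmax A (indicatorLeft S T) = Sum.inr '' (Sum.inr ⁻¹' A) := by
  have hl : ∀ s, Sum.inl s ∉ A := fun s hs => h ⟨s, hs⟩
  ext (k | k)
  · simp [argmax, hl]
  · simp only [argmax, Set.mem_ofPred_eq, Set.mem_image, Set.mem_preimage, Sum.inr.injEq,
      exists_eq_right, and_iff_left_iff_imp]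
    rintro - (l | l) hl'
    · exact absurd hl' (hl l)
    · simp

/-- The `𝟙_S`-maximal face of a product of associahedra is the product of the polytope of the
intersections of its block intervals with `S` and the polytope of the block intervals inside
`T`. -/
theorem IsBlockPolytope.exists_maxFace_eq_prodSet {P : Set (S ⊕ T → ℝ)} {f : S ⊕ T → α}
    {r : S ⊕ T → ℕ} (h : IsBlockPolytope P f r) (hfr : ∀ i j, f i = f j → r i = r j → i = j) :
    ∃ A B, maxFace P (indicatorLeft S T) = prodSet A B ∧
      IsBlockPolytope A (f ∘ Sum.inl) (r ∘ Sum.inl) ∧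
      IsBlockPolytope B (cutLabel f r) (r ∘ Sum.inr) := by
  classical
  obtain ⟨ι, _, D, rfl, hD⟩ := h
  have hne : ∀ i, (D i).Nonempty := fun i => nonempty_of_mem_blockIntervals (hD.le ⟨i, rfl⟩)
  let p : ι → Prop := fun i => (Sum.inl ⁻¹' D i).Nonempty
  refine ⟨hypergraphic fun i : {i // p i} => Sum.inl ⁻¹' D i,
    hypergraphic fun i : {i // ¬p i} => Sum.inr ⁻¹' D i, ?_, ⟨_, inferInstance, _, rfl, ?_⟩,
    ⟨_, inferInstance, _, rfl, ?_⟩⟩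
  · rw [maxFace_hypergraphic hne, prodSet_hypergraphic,
      ← hypergraphic_comp_equiv (Equiv.sumCompl p)]
    congr 1
    funext i
    rcases i with ⟨i, hi⟩ | ⟨i, hi⟩
    · exact argmax_indicatorLeft_of_nonempty hi
    · exact argmax_indicatorLeft_of_not_nonempty hi
  · rw [← preimage_inl_blockIntervals, ← hD]
    ext B
    constructor
    · rintro ⟨⟨i, hi⟩, rfl⟩
      exact ⟨_, ⟨i, rfl⟩, hi, rfl⟩
    · rintro ⟨_, ⟨i, rfl⟩, hi, rfl⟩
      exact ⟨⟨i, hi⟩, rfl⟩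
  · rw [← preimage_inr_blockIntervals hfr, ← hD]
    ext B
    constructor
    · rintro ⟨⟨i, hi⟩, rfl⟩
      exact ⟨_, ⟨i, rfl⟩, hi, rfl⟩
    · rintro ⟨_, ⟨i, rfl⟩, hi, rfl⟩
      exact ⟨⟨i, hi⟩, rfl⟩

theorem HasBlocks.isCoproduct {z : AssocClass (S ⊕ T)} {f : S ⊕ T → α} {r : S ⊕ T → ℕ}
    (h : HasBlocks z f r) {x : AssocClass S} {y : AssocClass T}
    (hx : HasBlocks x (f ∘ Sum.inl) (r ∘ Sum.inl)) (hy : HasBlocks y (cutLabel f r) (r ∘ Sum.inr)) :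
    IsCoproduct z x y := by
  obtain ⟨P, hP, hPb⟩ := exists_isAssocProduct_isBlockPolytope h.inj
  obtain ⟨A, B, he, hA, hB⟩ := hPb.exists_maxFace_eq_prodSet h.inj
  exact ⟨P, A, B, hP, h.fan_eq hPb, he, hx.fan_eq hA, hy.fan_eq hB⟩

theorem maxFace_maxFace_nonempty {P : Set (I → ℝ)} (hP : IsAssocProduct P) (v y : I → ℝ) :
    (maxFace (maxFace P v) y).Nonempty := by
  obtain ⟨f, r, -, ι, _, D, rfl, hD⟩ := hP.exists_isBlockPolytope
  have hne : ∀ i, (D i).Nonempty := fun i => nonempty_of_mem_blockIntervals (hD.le ⟨i, rfl⟩)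
  rw [maxFace_hypergraphic hne]
  exact maxFace_hypergraphic_nonempty (fun i => argmax_nonempty (hne i) v) y

/-- The coproduct does not depend on the choice of a polytope in the class. -/
theorem IsCoproduct.unique {z : AssocClass (S ⊕ T)} {x x' : AssocClass S} {y y' : AssocClass T}
    (h : IsCoproduct z x y) (h' : IsCoproduct z x' y') : x = x' ∧ y = y' := by
  obtain ⟨P, A, B, hP, hPz, hAB, hA, hB⟩ := h
  obtain ⟨P', A', B', hP', hPz', hAB', hA', hB'⟩ := h'
  have hfan : normalFan (prodSet A B) = normalFan (prodSet A' B') := by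
    rw [← hAB, ← hAB']
    have hPP := hPz.trans hPz'.symm
    obtain ⟨f, r, -, ι, _, D, rfl, hD⟩ := hP.exists_isBlockPolytope
    obtain ⟨f', r', -, κ, _, E, rfl, hE⟩ := hP'.exists_isBlockPolytope
    refine normalFan_maxFace_eq (fun i => nonempty_of_mem_blockIntervals (hD.le ⟨i, rfl⟩))
      (fun i => nonempty_of_mem_blockIntervals (hE.le ⟨i, rfl⟩)) hPP ?_
    rintro (i | i) <;> simp
  have hne : ∀ {A : Set (S → ℝ)} {B : Set (T → ℝ)} {P : Set (S ⊕ T → ℝ)}, IsAssocProduct P →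
      maxFace P (indicatorLeft S T) = prodSet A B →
      (∀ u, (maxFace A u).Nonempty) ∧ ∀ u, (maxFace B u).Nonempty := by
    intro A B P hP h
    have key : ∀ u : S ⊕ T → ℝ,
        (prodSet (maxFace A (u ∘ Sum.inl)) (maxFace B (u ∘ Sum.inr))).Nonempty := fun u => by
      rw [← maxFace_prodSet, ← h]
      exact maxFace_maxFace_nonempty hP _ u
    refine ⟨fun u => ?_, fun u => ?_⟩
    · obtain ⟨x, hx⟩ := key (Sum.elim u 0)
      exact ⟨_, hx.1⟩
    · obtain ⟨x, hx⟩ := key (Sum.elim 0 u)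
      exact ⟨_, hx.2⟩
  obtain ⟨h1, h2⟩ := normalFan_eq_of_prodSet (hne hP hAB).1 (hne hP hAB).2 (hne hP' hAB').1
    (hne hP' hAB').2 hfan
  exact ⟨AssocClass.fan_injective (hA.symm.trans (h1.trans hA')),
    AssocClass.fan_injective (hB.symm.trans (h2.trans hB'))⟩

theorem HasBlocks.exists_isCoproduct {z : AssocClass (S ⊕ T)} {f : S ⊕ T → α} {r : S ⊕ T → ℕ}
    (h : HasBlocks z f r) : ∃ x y, IsCoproduct z x y ∧
      HasBlocks x (f ∘ Sum.inl) (r ∘ Sum.inl) ∧ HasBlocks y (cutLabel f r) (r ∘ Sum.inr) := by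
  obtain ⟨x, hx⟩ := exists_class_hasBlocks (f := f ∘ Sum.inl) (r := r ∘ Sum.inl)
    fun i j h1 h2 => Sum.inl_injective (h.inj _ _ h1 h2)
  obtain ⟨y, hy⟩ := exists_class_hasBlocks (f := cutLabel f r) (r := r ∘ Sum.inr)
    fun i j h1 h2 => Sum.inr_injective (h.inj _ _ (congrArg Prod.fst h1) h2)
  exact ⟨x, y, h.isCoproduct hx hy, hx, hy⟩

/-! ### Isomorphism classes -/

theorem AssocClass.relabel_relabel {L : Type} [Fintype L] (z : AssocClass I) (σ : I ≃ J)
    (τ : J ≃ L) : (z.relabel σ).relabel τ = z.relabel (σ.trans τ) := by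
  induction z using Quotient.inductionOn with
  | h P => rfl

@[simp] theorem AssocClass.relabel_refl (z : AssocClass I) : z.relabel (Equiv.refl I) = z := by
  induction z using Quotient.inductionOn with
  | h P => rfl

theorem AssocClass.prod_relabel {I' J' : Type} [Fintype I'] [Fintype J'] (x : AssocClass I)
    (y : AssocClass J) (σ : I ≃ I') (τ : J ≃ J') :
    (x.relabel σ).prod (y.relabel τ) = (x.prod y).relabel (σ.sumCongr τ) := by
  induction x, y using Quotient.inductionOn₂ with
  | h P Q => rfl

theorem AssocClass.prod_relabel_sumComm (x : AssocClass I) (y : AssocClass J) :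
    (x.prod y).relabel (Equiv.sumComm I J) = y.prod x := by
  induction x, y using Quotient.inductionOn₂ with
  | h P Q =>
    refine congrArg (Quotient.mk _) (Subtype.ext ?_)
    ext u
    exact and_comm

theorem exists_perm_le_iff {n : ℕ} {g : Fin n → ℕ} (hg : Function.Injective g) :
    ∃ σ : Equiv.Perm (Fin n), ∀ i j, g (σ i) ≤ g (σ j) ↔ i ≤ j :=
  ⟨Tuple.sort g, fun _ _ => ((Tuple.monotone_sort g).strictMono_of_injective
    (hg.comp (Tuple.sort g).injective)).le_iff_le⟩

/-- The classes isomorphic to an associahedron are those with at most one block. -/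
theorem HasBlocks.isIso_stdAssoc_iff {n : ℕ} {w : AssocClass (Fin n)} {f : Fin n → α}
    {r : Fin n → ℕ} (h : HasBlocks w f r) :
    (∃ σ : Equiv.Perm (Fin n), (stdAssoc n).relabel σ = w) ↔ ∀ i j, f i = f j := by
  constructor
  · rintro ⟨σ, rfl⟩ i j
    exact (h.label_eq_iff ((hasBlocks_stdAssoc n).relabel_symm σ) i j).2 rfl
  · intro hf
    obtain ⟨σ, hσ⟩ := exists_perm_le_iff fun i j => h.inj i j (hf i j)
    refine ⟨σ, HasBlocks.unique (HasBlocks.relabel σ ?_) h⟩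
    exact (hasBlocks_stdAssoc n).congr (fun i j => by simp [hf (σ i) (σ j)])
      fun i j _ => (hσ i j).symm

/-- The class `a_s × a_t`, as a class on `[s + t]`. -/
abbrev stdProd (s t : ℕ) : AssocClass (Fin (s + t)) :=
  ((stdAssoc s).prod (stdAssoc t)).relabel finSumFinEquiv

/-- The labelling `f` is constant on a set of `s` elements and on its complement, with different
values (if both sets are nonempty). -/
def HasTwoBlocks (s t : ℕ) (f : Fin (s + t) → α) : Prop :=
  ∃ e : Fin s ⊕ Fin t ≃ Fin (s + t), (∀ i j, f (e (Sum.inl i)) = f (e (Sum.inl j))) ∧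
    (∀ i j, f (e (Sum.inr i)) = f (e (Sum.inr j))) ∧
    ∀ i j, f (e (Sum.inl i)) ≠ f (e (Sum.inr j))

/-- The classes isomorphic to `a_s × a_t` are those whose blocks are a set of `s` elements and its
complement. -/
theorem HasBlocks.isIso_stdProd_iff {s t : ℕ} {w : AssocClass (Fin (s + t))}
    {f : Fin (s + t) → α} {r : Fin (s + t) → ℕ} (h : HasBlocks w f r) :
    (∃ σ : Equiv.Perm (Fin (s + t)), (stdProd s t).relabel σ = w) ↔
      HasTwoBlocks s t f := by
  constructor
  · rintro ⟨σ, rfl⟩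
    let e : Fin s ⊕ Fin t ≃ Fin (s + t) := finSumFinEquiv.trans σ
    have hstd : HasBlocks ((stdProd s t).relabel σ)
        (fun i => (e.symm i).isLeft) (fun i => Sum.elim Fin.val Fin.val (e.symm i)) := by
      rw [AssocClass.relabel_relabel]
      refine HasBlocks.relabel e (HasBlocks.prod ?_ ?_ ?_)
      · exact (hasBlocks_stdAssoc s).congr (by simp) (by simp)
      · exact (hasBlocks_stdAssoc t).congr (by simp) (by simp)
      · simp
    have hiff := h.label_eq_iff hstd
    exact ⟨e, fun i j => by simp [hiff], fun i j => by simp [hiff], fun i j => by simp [hiff]⟩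
  · rintro ⟨e, hl, hr, hne⟩
    have hx : ∃ x : AssocClass (Fin s),
        HasBlocks x (f ∘ e ∘ Sum.inl) (r ∘ e ∘ Sum.inl) := exists_class_hasBlocks
      fun i j h1 h2 => Sum.inl_injective (e.injective (h.inj _ _ h1 h2))
    have hy : ∃ y : AssocClass (Fin t),
        HasBlocks y (f ∘ e ∘ Sum.inr) (r ∘ e ∘ Sum.inr) := exists_class_hasBlocks
      fun i j h1 h2 => Sum.inr_injective (e.injective (h.inj _ _ h1 h2))
    obtain ⟨x, hx⟩ := hx
    obtain ⟨y, hy⟩ := hy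
    obtain ⟨σ, hσ⟩ := hx.isIso_stdAssoc_iff.2 hl
    obtain ⟨τ, hτ⟩ := hy.isIso_stdAssoc_iff.2 hr
    refine ⟨finSumFinEquiv.symm.trans ((σ.sumCongr τ).trans e), ?_⟩
    have hxy : (x.prod y).relabel e = w :=
      HasBlocks.unique (HasBlocks.relabel e (HasBlocks.prod hx hy hne)) h
    rw [AssocClass.relabel_relabel, ← hxy, ← hσ, ← hτ, AssocClass.prod_relabel,
      AssocClass.relabel_relabel]
    congr 1
    ext i
    simp

/-- A class with at least two blocks is a product of two nontrivial classes. -/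
theorem HasBlocks.exists_eq_prod {n : ℕ} {w : AssocClass (Fin n)} {f : Fin n → α}
    {r : Fin n → ℕ} (h : HasBlocks w f r) (hf : ¬∀ i j, f i = f j) :
    ∃ s t, 1 ≤ s ∧ 1 ≤ t ∧ ∃ (e : Fin s ⊕ Fin t ≃ Fin n) (x : AssocClass (Fin s))
      (y : AssocClass (Fin t)), w = (x.prod y).relabel e := by
  classical
  push Not at hf
  obtain ⟨i, j, hij⟩ := hf
  let e₁ : {k // f k = f i} ≃ Fin (Fintype.card {k // f k = f i}) := Fintype.equivFin _
  let e₂ : {k // ¬f k = f i} ≃ Fin (Fintype.card {k // ¬f k = f i}) := Fintype.equivFin _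
  let e := (e₁.sumCongr e₂).symm.trans (Equiv.sumCompl fun k => f k = f i)
  obtain ⟨x, hx⟩ := exists_class_hasBlocks (f := f ∘ e ∘ Sum.inl) (r := r ∘ e ∘ Sum.inl)
    fun i j h1 h2 => Sum.inl_injective (e.injective (h.inj _ _ h1 h2))
  obtain ⟨y, hy⟩ := exists_class_hasBlocks (f := f ∘ e ∘ Sum.inr) (r := r ∘ e ∘ Sum.inr)
    fun i j h1 h2 => Sum.inr_injective (e.injective (h.inj _ _ h1 h2))
  refine ⟨_, _, Fintype.card_pos_iff.2 ⟨⟨i, rfl⟩⟩, Fintype.card_pos_iff.2 ⟨⟨j, Ne.symm hij⟩⟩, e,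
    x, y, HasBlocks.unique h (HasBlocks.relabel e (HasBlocks.prod hx hy fun a c hac => ?_))⟩
  exact (e₂.symm c).2 (hac.symm.trans (e₁.symm a).2)

end Classes

/-! ### Counting cuts -/

section Counting

variable {α : Type}

/-- There are `s + 1` intervals with `t` elements in `[s + t]`. -/
theorem card_intervals (s t : ℕ) (ht : 1 ≤ t) :
    ({U : Finset (Fin (s + t)) | U.card = t ∧
      ∀ a ∈ U, ∀ c ∈ U, ∀ k, a ≤ k → k ≤ c → k ∈ U} : Set (Finset (Fin (s + t)))).ncard
      = s + 1 := by
  classical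
  -- The intervals are the `V c = [c, c + t)` with `c ≤ s`.
  let V : ℕ → Finset (Fin (s + t)) := fun c => Finset.univ.filter fun i => c ≤ i ∧ (i : ℕ) < c + t
  have hV : ∀ c i, i ∈ V c ↔ c ≤ i ∧ (i : ℕ) < c + t := fun c i => by simp [V]
  have himage : ({U : Finset (Fin (s + t)) | U.card = t ∧
      ∀ a ∈ U, ∀ c ∈ U, ∀ k, a ≤ k → k ≤ c → k ∈ U} : Set (Finset (Fin (s + t)))) =
      V '' (Finset.range (s + 1) : Finset ℕ) := by
    ext U
    constructor
    · rintro ⟨hcard, hconn⟩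
      have hne : U.Nonempty := Finset.card_pos.1 (by omega)
      have hU : U = Finset.Icc (U.min' hne) (U.max' hne) := by
        ext k
        rw [Finset.mem_Icc]
        exact ⟨fun hk => ⟨U.min'_le k hk, U.le_max' k hk⟩, fun hk =>
          hconn _ (U.min'_mem hne) _ (U.max'_mem hne) k hk.1 hk.2⟩
      have hle : U.min' hne ≤ U.max' hne := U.min'_le_max' hne
      have hc : (U.max' hne : ℕ) + 1 - U.min' hne = t := by
        rw [← Fin.card_Icc, ← hU, hcard]
      have hlt := (U.max' hne).2
      rw [Fin.le_def] at hle
      refine ⟨U.min' hne, ?_, ?_⟩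
      · simp only [Finset.coe_range, Set.mem_Iio]
        omega
      · ext k
        rw [hV]
        conv_rhs => rw [hU]
        rw [Finset.mem_Icc, Fin.le_def, Fin.le_def]
        omega
    · rintro ⟨c, hc, rfl⟩
      simp only [Finset.coe_range, Set.mem_Iio] at hc
      refine ⟨?_, ?_⟩
      · have : (V c).map Fin.valEmbedding = Finset.Ico c (c + t) := by
          ext k
          simp only [Finset.mem_map, hV, Fin.valEmbedding_apply, Finset.mem_Ico]
          constructor
          · rintro ⟨i, hi, rfl⟩
            exact hi
          · intro hk
            exact ⟨⟨k, by omega⟩, hk, rfl⟩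
        rw [← Finset.card_map Fin.valEmbedding, this, Nat.card_Ico]
        omega
      · intro a ha d hd k h1 h2
        rw [hV] at *
        rw [Fin.le_def] at h1 h2
        omega
  rw [himage, Set.InjOn.ncard_image, Set.ncard_coe_finset, Finset.card_range]
  intro c hc d hd hcd
  simp only [Finset.coe_range, Set.mem_Iio] at hc hd
  have h1 := (hV d ⟨c, by omega⟩).1 (hcd ▸ (hV c ⟨c, by omega⟩).2 ⟨le_rfl, by simp; omega⟩)
  have h2 := (hV c ⟨d, by omega⟩).1 (hcd ▸ (hV d ⟨d, by omega⟩).2 ⟨le_rfl, by simp; omega⟩)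
  simp only at h1 h2
  omega

/-- `S` lies in one block, and its complement lies in one block and is not separated by elements
of `S`. These are the decompositions for which both factors of the coproduct have one block. -/
def IsCut {n : ℕ} (f : Fin n → α) (r : Fin n → ℕ) (S : Finset (Fin n)) : Prop :=
  (∀ i ∈ S, ∀ j ∈ S, f i = f j) ∧ ∀ i ∉ S, ∀ j ∉ S, f i = f j ∧
    ∀ k ∈ S, f k = f i → (r k < r i ↔ r k < r j)

/-- With a single block, a cut is the complement of an interval. -/
theorem card_isCut_of_forall_eq {s t : ℕ} (ht : 1 ≤ t) {f : Fin (s + t) → α}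
    {r : Fin (s + t) → ℕ} (hr : Function.Injective r) (hf : ∀ i j, f i = f j) :
    ({S : Finset (Fin (s + t)) | S.card = s ∧ IsCut f r S}).ncard = s + 1 := by
  classical
  obtain ⟨σ, hσ⟩ := exists_perm_le_iff hr
  have hlt : ∀ i j, r (σ i) < r (σ j) ↔ i < j := fun i j => by
    rw [← not_le, hσ, not_le]
  rw [← card_intervals s t ht]
  refine Set.ncard_congr (fun S _ => Sᶜ.map σ.symm.toEmbedding) ?_ ?_ ?_
  · rintro S ⟨hS, -, hcut⟩
    refine ⟨?_, ?_⟩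
    · rw [Finset.card_map, Finset.card_compl, hS, Fintype.card_fin, Nat.add_sub_cancel_left]
    · intro a ha c hc k hak hkc
      simp only [Finset.mem_map_equiv, Equiv.symm_symm, Finset.mem_compl] at *
      intro hk
      have hkc' : k < c := lt_of_le_of_ne hkc fun h => hc (h ▸ hk)
      have := ((hcut _ ha _ hc).2 _ hk (hf _ _)).2 ((hlt _ _).2 hkc')
      exact absurd ((hlt _ _).1 this) (not_lt.2 hak)
  · intro S S' _ _ h
    exact compl_injective (Finset.map_injective _ h)
  · rintro U ⟨hU, hconn⟩
    have hmem : ∀ i, σ i ∈ (U.map σ.toEmbedding)ᶜ ↔ i ∉ U := by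
      intro i; simp
    refine ⟨(U.map σ.toEmbedding)ᶜ, ⟨?_, fun i _ j _ => hf i j, ?_⟩, ?_⟩
    · rw [Finset.card_compl, Finset.card_map, hU, Fintype.card_fin, Nat.add_sub_cancel]
    · intro i hi j hj
      refine ⟨hf i j, fun k hk _ => ?_⟩
      obtain ⟨i, rfl⟩ := σ.surjective i
      obtain ⟨j, rfl⟩ := σ.surjective j
      obtain ⟨k, rfl⟩ := σ.surjective k
      rw [hmem] at hi hj hk
      rw [not_not] at hi hj
      rw [hlt, hlt]
      constructor
      · intro h
        by_contra hjk
        exact hk (hconn j hj i hi k (not_lt.1 hjk) h.le)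
      · intro h
        by_contra hik
        exact hk (hconn i hi j hj k (not_lt.1 hik) h.le)
    · ext i
      simp

theorem finSumEquivOfFinset_inl_mem {n s t : ℕ} {S : Finset (Fin n)} (hS : S.card = s)
    (hSc : Sᶜ.card = t) (i : Fin s) : finSumEquivOfFinset hS hSc (Sum.inl i) ∈ S := by
  rw [finSumEquivOfFinset_inl]
  exact Finset.orderEmbOfFin_mem _ _ _

theorem finSumEquivOfFinset_inr_notMem {n s t : ℕ} {S : Finset (Fin n)} (hS : S.card = s)
    (hSc : Sᶜ.card = t) (i : Fin t) : finSumEquivOfFinset hS hSc (Sum.inr i) ∉ S := by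
  rw [finSumEquivOfFinset_inr, ← Finset.mem_compl]
  exact Finset.orderEmbOfFin_mem _ _ _

/-- With several blocks, a cut consists of two blocks of the sizes `s` and `t`. It is unique up to
the exchange of the two blocks, which is possible for `s = t`. -/
theorem card_isCut_of_not_forall_eq {s t : ℕ} (hs : 1 ≤ s) {f : Fin (s + t) → α}
    {r : Fin (s + t) → ℕ} (hf : ¬∀ i j, f i = f j) [Decidable (HasTwoBlocks s t f)] :
    ({S : Finset (Fin (s + t)) | S.card = s ∧ IsCut f r S}).ncard =
      if HasTwoBlocks s t f then (if s = t then 2 else 1) else 0 := by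
  classical
  -- If `S` and its complement shared a label, there would be only one block.
  have hsep : ∀ S, IsCut f r S → ∀ i ∈ S, ∀ j ∉ S, f i ≠ f j := by
    rintro S ⟨h1, h2⟩ i hi j hj hij
    have hi' : ∀ k, f k = f i := fun k => by
      by_cases hk : k ∈ S
      · exact h1 k hk i hi
      · exact (h2 k hk j hj).1.trans hij.symm
    exact hf fun a c => (hi' a).trans (hi' c).symm
  by_cases he : HasTwoBlocks s t f
  · rw [if_pos he]
    obtain ⟨e, hl, hr, hne⟩ := he
    let S₀ : Finset (Fin (s + t)) := Finset.univ.map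
      (Function.Embedding.inl.trans e.toEmbedding)
    have hinl : ∀ i, e (Sum.inl i) ∈ S₀ := fun i => by simp [S₀]
    have hinr : ∀ i, e (Sum.inr i) ∉ S₀ := fun i => by simp [S₀]
    have hcard : S₀.card = s := by simp [S₀]
    have hcompl : S₀ᶜ.card = t := by
      rw [Finset.card_compl, hcard, Fintype.card_fin, Nat.add_sub_cancel_left]
    have hcut : IsCut f r S₀ := by
      refine ⟨fun i hi j hj => ?_, fun i hi j hj => ⟨?_, fun k hk hki => ?_⟩⟩
      all_goals
        obtain ⟨i | i, rfl⟩ := e.surjective i <;> obtain ⟨j | j, rfl⟩ := e.surjective j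
        all_goals first | exact absurd hi (hinr _) | exact absurd hj (hinr _) |
          exact absurd (hinl _) hi | exact absurd (hinl _) hj | skip
      · exact hl i j
      · exact hr i j
      · obtain ⟨k | k, rfl⟩ := e.surjective k
        · exact absurd hki (hne _ _)
        · exact absurd hk (hinr _)
    have hcut' : IsCut f r S₀ᶜ := by
      refine ⟨fun i hi j hj => (hcut.2 i (by simpa using hi) j (by simpa using hj)).1,
        fun i hi j hj => ?_⟩
      rw [Finset.mem_compl, not_not] at hi hj
      refine ⟨hcut.1 i hi j hj, fun k hk hki => ?_⟩
      exact absurd hki.symm (hsep _ hcut i hi k (by simpa using hk))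
    have heq : ∀ S, IsCut f r S → S.card = s → S = S₀ ∨ S = S₀ᶜ := by
      intro S hS hSc
      have hfib : ∀ S', IsCut f r S' → ∀ i ∈ S', ∀ k, k ∈ S' ↔ f k = f i := fun S' hS' i hi k =>
        ⟨fun hk => hS'.1 k hk i hi, fun hk => by
          by_contra hk'
          exact hsep S' hS' i hi k hk' hk.symm⟩
      obtain ⟨a, ha⟩ : S.Nonempty := Finset.card_pos.1 (by omega)
      by_cases ha0 : a ∈ S₀
      · left
        ext k
        rw [hfib S hS a ha, hfib S₀ hcut a ha0]
      · right
        ext k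
        rw [hfib S hS a ha, hfib S₀ᶜ hcut' a (by simpa using ha0)]
    split_ifs with hst
    · have : {S : Finset (Fin (s + t)) | S.card = s ∧ IsCut f r S} = {S₀, S₀ᶜ} := by
        ext S
        constructor
        · rintro ⟨h1, h2⟩
          exact heq S h2 h1
        · rintro (rfl | rfl)
          · exact ⟨hcard, hcut⟩
          · exact ⟨hcompl.trans hst.symm, hcut'⟩
      rw [this, Set.ncard_pair]
      intro h
      have h0 := hinl ⟨0, hs⟩
      exact Finset.mem_compl.1 (h ▸ h0) h0
    · have : {S : Finset (Fin (s + t)) | S.card = s ∧ IsCut f r S} = {S₀} := by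
        ext S
        constructor
        · rintro ⟨h1, h2⟩
          rcases heq S h2 h1 with h | h
          · exact h
          · exact absurd (h1.symm.trans (h ▸ hcompl)) hst
        · rintro rfl
          exact ⟨hcard, hcut⟩
      rw [this, Set.ncard_singleton]
  · rw [if_neg he, Set.ncard_eq_zero, Set.eq_empty_iff_forall_notMem]
    rintro S ⟨hS, hcut⟩
    have hSc : Sᶜ.card = t := by
      rw [Finset.card_compl, hS, Fintype.card_fin, Nat.add_sub_cancel_left]
    have hl := finSumEquivOfFinset_inl_mem hS hSc
    have hr := finSumEquivOfFinset_inr_notMem hS hSc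
    exact he ⟨_, fun i j => hcut.1 _ (hl i) _ (hl j), fun i j => (hcut.2 _ (hr i) _ (hr j)).1,
      fun i j => hsep S hcut _ (hl i) _ (hr j)⟩

end Counting

/-! ### The product of two associahedra in the dual -/

section Product

variable (K : Type*) [Field K]

open Classical in
/-- The component of `isoDual` in the dual space of `Ā[n]`. -/
def isoFun {n : ℕ} (z : AssocClass (Fin n)) : AbarDual K (Fin n) :=
  Finsupp.lift K K _ fun w => if ∃ σ : Equiv.Perm (Fin n), z.relabel σ = w then 1 else 0

theorem isoDual_eq {n : ℕ} (z : AssocClass (Fin n)) :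
    isoDual K z = FullFock.of K n (isoFun K z) := rfl

theorem isoFun_single {n : ℕ} {z w : AssocClass (Fin n)} {p : Prop} [Decidable p]
    (h : (∃ σ : Equiv.Perm (Fin n), z.relabel σ = w) ↔ p) :
    isoFun K z (Finsupp.single w 1) = if p then 1 else 0 := by
  simp [isoFun, h]

variable {K}

theorem AbarDual.ext {I : Type} [Fintype I] {φ ψ : AbarDual K I}
    (h : ∀ w, φ (Finsupp.single w 1) = ψ (Finsupp.single w 1)) : φ = ψ :=
  Finsupp.lhom_ext' fun w => LinearMap.ext_ring (h w)

@[simp] theorem AbarDual.relabel_single {I J : Type} [Fintype I] [Fintype J] (σ : I ≃ J)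
    (φ : AbarDual K I) (w : AssocClass J) :
    AbarDual.relabel K σ φ (Finsupp.single w 1) = φ (Finsupp.single (w.relabel σ.symm) 1) := by
  simp [AbarDual.relabel, Abar.relabel]

theorem Abar.comul_single {S T : Type} [Fintype S] [Fintype T] {z : AssocClass (S ⊕ T)}
    {x : AssocClass S} {y : AssocClass T} (h : IsCoproduct z x y) :
    Abar.comul K S T (Finsupp.single z 1) = Finsupp.single x 1 ⊗ₜ[K] Finsupp.single y 1 := by
  have : Abar.comul K S T (Finsupp.single z 1) =
      ∑ᶠ (p : AssocClass S × AssocClass T) (_ : IsCoproduct z p.1 p.2),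
        (Finsupp.single p.1 1 : Abar K S) ⊗ₜ[K] (Finsupp.single p.2 1 : Abar K T) := by
    simp [Abar.comul]
  rw [this, finsum_eq_single _ (x, y)]
  · have : Unique (IsCoproduct z x y) := ⟨⟨h⟩, fun _ => rfl⟩
    exact finsum_unique _
  · rintro ⟨x', y'⟩ hne
    have : IsEmpty (IsCoproduct z x' y') := ⟨fun h' => hne (Prod.ext_iff.2 (h'.unique h))⟩
    exact finsum_of_isEmpty _

theorem AbarDual.mul_single {S T : Type} [Fintype S] [Fintype T] {z : AssocClass (S ⊕ T)}
    {x : AssocClass S} {y : AssocClass T} (h : IsCoproduct z x y) (φ : AbarDual K S)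
    (ψ : AbarDual K T) : AbarDual.mul K S T (φ ⊗ₜ ψ) (Finsupp.single z 1) =
      φ (Finsupp.single x 1) * ψ (Finsupp.single y 1) := by
  simp [AbarDual.mul, Abar.comul_single h]

theorem FullFock.mul_of_of {s t : ℕ} (φ : AbarDual K (Fin s)) (ψ : AbarDual K (Fin t)) :
    FullFock.mul K (FullFock.of K s φ) (FullFock.of K t ψ) =
      FullFock.of K (s + t) (FullFock.mulComponent K s t (φ ⊗ₜ ψ)) := by
  simp [FullFock.mul, FullFock.of, DirectSum.toModule_lof]

/-- The term of `a_s^* · a_t^*` that belongs to the decomposition `[s + t] = S ⊔ Sᶜ`. -/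
theorem mul_isoFun_single {s t : ℕ} {α : Type} {w : AssocClass (Fin (s + t))}
    {f : Fin (s + t) → α} {r : Fin (s + t) → ℕ} (h : HasBlocks w f r) {S : Finset (Fin (s + t))}
    (e : Fin s ⊕ Fin t ≃ Fin (s + t)) (hl : ∀ i, e (Sum.inl i) ∈ S) (hr : ∀ i, e (Sum.inr i) ∉ S)
    [Decidable (IsCut f r S)] :
    AbarDual.mul K (Fin s) (Fin t) (isoFun K (stdAssoc s) ⊗ₜ isoFun K (stdAssoc t))
      (Finsupp.single (w.relabel e.symm) 1) = if IsCut f r S then 1 else 0 := by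
  classical
  have hw : HasBlocks (w.relabel e.symm) (f ∘ e) (r ∘ e) := h.relabel_symm e.symm
  obtain ⟨x, y, hxy, hx, hy⟩ := hw.exists_isCoproduct
  have hcut : IsCut f r S ↔ (∀ i j, f (e (Sum.inl i)) = f (e (Sum.inl j))) ∧
      ∀ i j, cutLabel (f ∘ e) (r ∘ e) i = cutLabel (f ∘ e) (r ∘ e) j := by
    constructor
    · rintro ⟨h1, h2⟩
      refine ⟨fun i j => h1 _ (hl i) _ (hl j), fun i j => ?_⟩
      obtain ⟨h3, h4⟩ := h2 _ (hr i) _ (hr j)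
      refine Prod.ext h3 (Set.ext fun k => ?_)
      constructor
      · rintro ⟨hk, hk'⟩
        exact ⟨hk.trans h3, (h4 _ (hl k) hk).1 hk'⟩
      · rintro ⟨hk, hk'⟩
        exact ⟨hk.trans h3.symm, (h4 _ (hl k) (hk.trans h3.symm)).2 hk'⟩
    · rintro ⟨h1, h2⟩
      refine ⟨fun i hi j hj => ?_, fun i hi j hj => ?_⟩
      all_goals
        obtain ⟨i | i, rfl⟩ := e.surjective i <;> obtain ⟨j | j, rfl⟩ := e.surjective j
        all_goals first | exact absurd hi (hr _) | exact absurd hj (hr _) |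
          exact absurd (hl _) hi | exact absurd (hl _) hj | skip
      · exact h1 i j
      · have hf : f (e (Sum.inr i)) = f (e (Sum.inr j)) := congrArg Prod.fst (h2 i j)
        refine ⟨hf, fun k hk hki => ?_⟩
        obtain ⟨k | k, rfl⟩ := e.surjective k
        · have := Set.ext_iff.1 (congrArg Prod.snd (h2 i j)) k
          simpa [cutLabel, hki, hf] using this
        · exact absurd hk (hr _)
  rw [AbarDual.mul_single hxy, isoFun_single K hx.isIso_stdAssoc_iff,
    isoFun_single K hy.isIso_stdAssoc_iff]
  rw [ite_zero_mul_ite_zero, mul_one]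
  exact if_congr hcut.symm rfl rfl

/-- The coefficient of `a_s^* · a_t^*` at a class is the number of its cuts. -/
theorem mulComponent_isoFun_single {s t : ℕ} {α : Type} {w : AssocClass (Fin (s + t))}
    {f : Fin (s + t) → α} {r : Fin (s + t) → ℕ} (h : HasBlocks w f r) :
    FullFock.mulComponent K s t (isoFun K (stdAssoc s) ⊗ₜ isoFun K (stdAssoc t))
      (Finsupp.single w 1) =
      (({S : Finset (Fin (s + t)) | S.card = s ∧ IsCut f r S}).ncard : K) := by
  classical
  have hterm : ∀ S : {S : Finset (Fin (s + t)) // S.card = s}, ∀ hSc : (S.1)ᶜ.card = t,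
      AbarDual.mul K (Fin s) (Fin t) (isoFun K (stdAssoc s) ⊗ₜ isoFun K (stdAssoc t))
        (Finsupp.single (w.relabel (finSumEquivOfFinset S.2 hSc).symm) 1) =
      if IsCut f r S then 1 else 0 := by
    intro S hSc
    exact mul_isoFun_single h _ (finSumEquivOfFinset_inl_mem S.2 hSc)
      (finSumEquivOfFinset_inr_notMem S.2 hSc)
  simp only [FullFock.mulComponent, LinearMap.sum_apply, LinearMap.comp_apply,
    AbarDual.relabel_single, hterm]
  rw [← Finset.sum_subtype (Finset.univ.filter fun S : Finset (Fin (s + t)) => S.card = s)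
    (by simp) (fun S => if IsCut f r S then (1 : K) else 0), Finset.sum_boole,
    Finset.filter_filter, ← Set.ncard_coe_finset]
  congr 3
  ext S
  simp

/-- `a_s^* · a_t^* = (s + 1) a_{s+t}^* + ε_{s,t} (a_s × a_t)^*`. -/
theorem mul_assocDual {s t : ℕ} (hs : 1 ≤ s) (ht : 1 ≤ t) :
    FullFock.mul K (assocDual K s) (assocDual K t) =
      ((s : K) + 1) • assocDual K (s + t) +
        (if s = t then (2 : K) else 1) • assocProdDual K s t := by
  classical
  have hprod : assocProdDual K s t = FullFock.of K (s + t) (isoFun K (stdProd s t)) := rfl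
  rw [hprod, assocDual, assocDual, assocDual, isoDual_eq, isoDual_eq, isoDual_eq,
    FullFock.mul_of_of, ← map_smul, ← map_smul, ← map_add]
  congr 1
  refine AbarDual.ext fun w => ?_
  obtain ⟨f, r, h⟩ := exists_hasBlocks w
  rw [mulComponent_isoFun_single h, LinearMap.add_apply, LinearMap.smul_apply,
    LinearMap.smul_apply, isoFun_single K h.isIso_stdAssoc_iff,
    isoFun_single K h.isIso_stdProd_iff]
  by_cases hf : ∀ i j, f i = f j
  · rw [card_isCut_of_forall_eq ht (fun i j => h.inj i j (hf i j)) hf, if_pos hf,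
      if_neg (c := HasTwoBlocks s t f)]
    · simp
    · rintro ⟨e, -, -, hne⟩
      exact hne ⟨0, hs⟩ ⟨0, ht⟩ (hf _ _)
  · rw [card_isCut_of_not_forall_eq hs hf, if_neg hf]
    split_ifs <;> simp

theorem isoDual_eq_of_relabel {m n : ℕ} {z : AssocClass (Fin m)} {z' : AssocClass (Fin n)}
    (e : Fin m ≃ Fin n) (h : z.relabel e = z') : isoDual K z = isoDual K z' := by
  obtain rfl : m = n := Fin.equiv_iff_eq.1 ⟨e⟩
  rw [isoDual_eq, isoDual_eq]
  congr 1
  classical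
  refine AbarDual.ext fun w => ?_
  rw [isoFun_single K Iff.rfl,
    isoFun_single K (p := ∃ σ : Equiv.Perm (Fin m), z.relabel σ = w)]
  constructor
  · rintro ⟨σ, rfl⟩
    exact ⟨e.trans σ, by rw [← h, AssocClass.relabel_relabel]⟩
  · rintro ⟨σ, rfl⟩
    refine ⟨e.symm.trans σ, ?_⟩
    rw [← h, AssocClass.relabel_relabel, ← Equiv.trans_assoc, Equiv.self_trans_symm,
      Equiv.refl_trans]

theorem assocProdDual_comm (s t : ℕ) : assocProdDual K s t = assocProdDual K t s := by
  refine isoDual_eq_of_relabel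
    ((finSumFinEquiv.symm.trans (Equiv.sumComm _ _)).trans finSumFinEquiv) ?_
  rw [← AssocClass.prod_relabel_sumComm, AssocClass.relabel_relabel, AssocClass.relabel_relabel]
  congr 1
  ext i
  simp

theorem bracket_assocDual {s t : ℕ} (hs : 1 ≤ s) (ht : 1 ≤ t) :
    bracket K (assocDual K s) (assocDual K t) = ((s : K) - (t : K)) • assocDual K (s + t) := by
  have hε : (if t = s then (2 : K) else 1) = if s = t then 2 else 1 := by simp only [eq_comm]
  rw [bracket, mul_assocDual hs ht, mul_assocDual ht hs, add_comm t s, assocProdDual_comm t s, hε]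
  module

end Product

/-! ### Primitive elements -/

section Primitive

variable {K : Type*} [Field K]

/-- The component in degree `0` of the unit. -/
abbrev unitFun (K : Type*) [Field K] : AbarDual K (Fin 0) := Finsupp.lift K K _ fun _ => 1

theorem unitFun_single (x : AssocClass (Fin 0)) : unitFun K (Finsupp.single x 1) = 1 := by
  simp [unitFun]

@[simp] theorem FullFock.one_apply_of_ne {n : ℕ} (hn : n ≠ 0) : FullFock.one K n = 0 :=
  DFinsupp.single_eq_of_ne hn

@[simp] theorem FullFock.one_apply_zero : FullFock.one K 0 = unitFun K :=
  DirectSum.lof_apply K 0 _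

theorem AbarDual.comul_eq_iff {S T : Type} [Fintype S] [Fintype T] {ψ : AbarDual K (S ⊕ T)}
    {X : AbarDual K S ⊗[K] AbarDual K T} : AbarDual.comul K S T ψ = X ↔
      ∀ x y, ψ (Finsupp.single (x.prod y) 1) = TensorProduct.dualDistrib K (Abar K S) (Abar K T) X
        (Finsupp.single x 1 ⊗ₜ Finsupp.single y 1) := by
  have hX : TensorProduct.dualDistrib K (Abar K S) (Abar K T) X =
      TensorProduct.dualDistribEquiv K (Abar K S) (Abar K T) X := rfl
  have hmul : ∀ x y, (Abar.mul K S T).dualMap ψ (Finsupp.single x 1 ⊗ₜ Finsupp.single y 1) =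
      ψ (Finsupp.single (x.prod y) 1) := fun x y => by simp [Abar.mul]
  simp only [AbarDual.comul, LinearMap.comp_apply, LinearEquiv.coe_coe,
    LinearEquiv.symm_apply_eq, ← hX, ← hmul]
  constructor
  · intro h x y
    rw [h]
  · intro h
    refine TensorProduct.ext (Finsupp.lhom_ext' fun x => LinearMap.ext_ring
      (Finsupp.lhom_ext' fun y => LinearMap.ext_ring (h x y)))

theorem FullFock.comul_of {n : ℕ} (φ : AbarDual K (Fin n)) :
    FullFock.comul K (FullFock.of K n φ) =
      ∑ p : {p : ℕ × ℕ // p ∈ Finset.HasAntidiagonal.antidiagonal n},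
        TensorProduct.map (FullFock.of K p.1.1) (FullFock.of K p.1.2)
          (AbarDual.comul K (Fin p.1.1) (Fin p.1.2) (AbarDual.relabel K
            (finSumFinEquiv.trans (finCongr (Finset.HasAntidiagonal.mem_antidiagonal.1 p.2))).symm
            φ)) := by
  simp [FullFock.comul, FullFock.of, DirectSum.toModule_lof]

/-- The component of the coproduct in bidegree `(s, t)`. -/
theorem FullFock.map_component_comul (s t : ℕ) (f : FullFock K) :
    TensorProduct.map (DirectSum.component K ℕ (fun n => AbarDual K (Fin n)) s)
      (DirectSum.component K ℕ (fun n => AbarDual K (Fin n)) t) (FullFock.comul K f) =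
    AbarDual.comul K (Fin s) (Fin t) (AbarDual.relabel K finSumFinEquiv.symm (f (s + t))) := by
  induction f using DirectSum.induction_on with
  | zero => simp
  | add f g hf hg => simp only [map_add, hf, hg, DirectSum.add_apply]
  | of n φ =>
    change TensorProduct.map _ _ (FullFock.comul K (FullFock.of K n φ)) =
      AbarDual.comul K _ _ (AbarDual.relabel K _ (FullFock.of K n φ (s + t)))
    have hcomp : ∀ m k, k ≠ m → DirectSum.component K ℕ (fun n => AbarDual K (Fin n)) m ∘ₗ
        FullFock.of K k = 0 := fun m k h => by
      rw [DirectSum.component_comp_lof, dif_neg h]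
    have hmap : ∀ a c (X : AbarDual K (Fin a) ⊗[K] AbarDual K (Fin c)),
        TensorProduct.map (DirectSum.component K ℕ (fun n => AbarDual K (Fin n)) s)
          (DirectSum.component K ℕ (fun n => AbarDual K (Fin n)) t)
          (TensorProduct.map (FullFock.of K a) (FullFock.of K c) X) =
        TensorProduct.map (DirectSum.component K ℕ (fun n => AbarDual K (Fin n)) s ∘ₗ
            FullFock.of K a)
          (DirectSum.component K ℕ (fun n => AbarDual K (Fin n)) t ∘ₗ FullFock.of K c) X := by
      intro a c X
      rw [TensorProduct.map_comp]
      rfl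
    have hzero : ∀ a c (X : AbarDual K (Fin a) ⊗[K] AbarDual K (Fin c)), (a, c) ≠ (s, t) →
        TensorProduct.map (DirectSum.component K ℕ (fun n => AbarDual K (Fin n)) s)
          (DirectSum.component K ℕ (fun n => AbarDual K (Fin n)) t)
          (TensorProduct.map (FullFock.of K a) (FullFock.of K c) X) = 0 := by
      intro a c X hne
      rw [hmap]
      by_cases ha : a = s
      · rw [hcomp t c fun hc => hne (Prod.ext ha hc), TensorProduct.map_zero_right,
          LinearMap.zero_apply]
      · rw [hcomp s a ha, TensorProduct.map_zero_left, LinearMap.zero_apply]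
    rw [FullFock.comul_of, map_sum]
    by_cases hn : n = s + t
    · subst hn
      rw [Finset.sum_eq_single ⟨(s, t), Finset.HasAntidiagonal.mem_antidiagonal.2 rfl⟩]
      · rw [hmap, DirectSum.component_comp_lof_same, DirectSum.component_comp_lof_same,
          TensorProduct.map_id, LinearMap.id_apply, DirectSum.lof_apply]
        rfl
      · rintro ⟨⟨a, c⟩, hp⟩ - hne
        exact hzero a c _ fun h => hne (Subtype.ext h)
      · exact fun h => absurd (Finset.mem_univ _) h
    · have h0 : FullFock.of K n φ (s + t) = 0 := DFinsupp.single_eq_of_ne (Ne.symm hn)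
      rw [h0, map_zero, map_zero]
      refine Finset.sum_eq_zero ?_
      rintro ⟨⟨a, c⟩, hp⟩ -
      refine hzero a c _ fun h => hn ?_
      rw [← Finset.HasAntidiagonal.mem_antidiagonal.1 hp, h]

/-- A primitive element, evaluated at a product of classes. -/
theorem apply_prod_of_mem_primitives {f : FullFock K} (hf : f ∈ primitives K) {s t : ℕ}
    (x : AssocClass (Fin s)) (y : AssocClass (Fin t)) :
    f (s + t) (Finsupp.single ((x.prod y).relabel finSumFinEquiv) 1) =
      f s (Finsupp.single x 1) * FullFock.one K t (Finsupp.single y 1) +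
        FullFock.one K s (Finsupp.single x 1) * f t (Finsupp.single y 1) := by
  have h := FullFock.map_component_comul s t f
  rw [hf.2, map_add, TensorProduct.map_tmul, TensorProduct.map_tmul] at h
  have := AbarDual.comul_eq_iff.1 h.symm x y
  rw [AbarDual.relabel_single, Equiv.symm_symm, map_add, LinearMap.add_apply,
    TensorProduct.dualDistrib_apply, TensorProduct.dualDistrib_apply] at this
  exact this

/-- The class of the point `ℝ^∅` is a unit for the product of classes. -/
theorem prod_relabel_of_isEmpty_left {n : ℕ} (x : AssocClass (Fin 0)) (y : AssocClass (Fin n))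
    (e : Fin 0 ⊕ Fin n ≃ Fin n) (he : ∀ i, e (Sum.inr i) = i) : (x.prod y).relabel e = y := by
  obtain ⟨f, r, h⟩ := exists_hasBlocks y
  obtain ⟨g, q, hx⟩ := exists_hasBlocks x
  refine HasBlocks.unique (HasBlocks.relabel e (HasBlocks.prod ?_ ?_ fun i => i.elim0)) h
  · exact hx.congr (fun i => i.elim0) fun i => i.elim0
  · exact h.congr (fun i j => by simp [he]) fun i j _ => by simp [he]

theorem prod_relabel_of_isEmpty_right {n : ℕ} (x : AssocClass (Fin n)) (y : AssocClass (Fin 0))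
    (e : Fin n ⊕ Fin 0 ≃ Fin n) (he : ∀ i, e (Sum.inl i) = i) : (x.prod y).relabel e = x := by
  rw [← AssocClass.prod_relabel_sumComm, AssocClass.relabel_relabel]
  exact prod_relabel_of_isEmpty_left _ _ _ he

theorem relabel_isoFun {n : ℕ} (z : AssocClass (Fin n)) (σ : Equiv.Perm (Fin n)) :
    AbarDual.relabel K σ (isoFun K z) = isoFun K z := by
  classical
  refine AbarDual.ext fun w => ?_
  rw [AbarDual.relabel_single, isoFun_single K Iff.rfl,
    isoFun_single K (p := ∃ τ : Equiv.Perm (Fin n), z.relabel τ = w.relabel σ.symm)]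
  constructor
  · rintro ⟨τ, rfl⟩
    exact ⟨τ.trans σ.symm, by rw [AssocClass.relabel_relabel]⟩
  · rintro ⟨τ, hτ⟩
    refine ⟨τ.trans σ, ?_⟩
    rw [← AssocClass.relabel_relabel, hτ, AssocClass.relabel_relabel, Equiv.symm_trans_self,
      AssocClass.relabel_refl]

theorem isoDual_mem_fockAlg {n : ℕ} (z : AssocClass (Fin n)) : isoDual K z ∈ FockAlg K := by
  intro m σ
  by_cases hm : m = n
  · subst hm
    rw [isoDual_eq, DirectSum.lof_apply, relabel_isoFun]
  · have h0 : isoDual K z m = 0 := DFinsupp.single_eq_of_ne hm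
    rw [h0, map_zero]

/-- The functional `a_n^*` vanishes on products of nontrivial classes. -/
theorem isoFun_stdAssoc_prod {n s t : ℕ} (hs : s ≠ 0) (ht : t ≠ 0) (e : Fin s ⊕ Fin t ≃ Fin n)
    (x : AssocClass (Fin s)) (y : AssocClass (Fin t)) :
    isoFun K (stdAssoc n) (Finsupp.single ((x.prod y).relabel e) 1) = 0 := by
  obtain ⟨f, r, hx⟩ := exists_hasBlocks x
  obtain ⟨g, q, hy⟩ := exists_hasBlocks y
  have h : HasBlocks ((x.prod y).relabel e) (Sum.map f g ∘ e.symm) (Sum.elim r q ∘ e.symm) := by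
    refine HasBlocks.relabel_symm (HasBlocks.prod ?_ ?_ (by simp)) e
    · exact hx.congr (by simp) (by simp)
    · exact hy.congr (by simp) (by simp)
  rw [isoFun_single K (p := False), if_neg not_false]
  rw [h.isIso_stdAssoc_iff, iff_false]
  intro hc
  have := hc (e (Sum.inl ⟨0, Nat.pos_of_ne_zero hs⟩)) (e (Sum.inr ⟨0, Nat.pos_of_ne_zero ht⟩))
  simp at this

theorem assocDual_mem_primitives {n : ℕ} (hn : n ≠ 0) : assocDual K n ∈ primitives K := by
  refine ⟨isoDual_mem_fockAlg _, ?_⟩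
  have hadd : ∀ {s t}, (s, t) ∈ Finset.HasAntidiagonal.antidiagonal n → s + t = n := fun h =>
    Finset.HasAntidiagonal.mem_antidiagonal.1 h
  have h0 : (0, n) ∈ Finset.HasAntidiagonal.antidiagonal n := by simp
  have h1 : (n, 0) ∈ Finset.HasAntidiagonal.antidiagonal n := by simp
  rw [assocDual, isoDual_eq, FullFock.comul_of,
    Finset.sum_eq_add (⟨(n, 0), h1⟩ : {p // p ∈ Finset.HasAntidiagonal.antidiagonal n}) ⟨(0, n), h0⟩]
  · congr 1
    · have : AbarDual.comul K (Fin n) (Fin 0) (AbarDual.relabel K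
          (finSumFinEquiv.trans (finCongr (hadd h1))).symm (isoFun K (stdAssoc n))) =
          isoFun K (stdAssoc n) ⊗ₜ unitFun K := by
        refine AbarDual.comul_eq_iff.2 fun x y => ?_
        rw [AbarDual.relabel_single, Equiv.symm_symm, prod_relabel_of_isEmpty_right,
          TensorProduct.dualDistrib_apply, unitFun_single, mul_one]
        intro i
        ext
        exact congrArg Fin.val (finSumFinEquiv_apply_left (n := 0) i)
      rw [this, TensorProduct.map_tmul]
      rfl
    · have : AbarDual.comul K (Fin 0) (Fin n) (AbarDual.relabel K
          (finSumFinEquiv.trans (finCongr (hadd h0))).symm (isoFun K (stdAssoc n))) =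
          unitFun K ⊗ₜ isoFun K (stdAssoc n) := by
        refine AbarDual.comul_eq_iff.2 fun x y => ?_
        rw [AbarDual.relabel_single, Equiv.symm_symm, prod_relabel_of_isEmpty_left,
          TensorProduct.dualDistrib_apply, unitFun_single, one_mul]
        intro i
        ext
        simp
      rw [this, TensorProduct.map_tmul]
      rfl
  · intro h
    exact hn (congrArg (fun p => p.1.1) h)
  · rintro ⟨⟨s, t⟩, hp⟩ - ⟨hne1, hne2⟩
    have hst := hadd hp
    have hs : s ≠ 0 := by
      rintro rfl
      exact hne2 (Subtype.ext (Prod.ext rfl (by simpa using hst)))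
    have ht : t ≠ 0 := by
      rintro rfl
      exact hne1 (Subtype.ext (Prod.ext (by simpa using hst) rfl))
    have : AbarDual.comul K (Fin s) (Fin t) (AbarDual.relabel K
        (finSumFinEquiv.trans (finCongr hst)).symm (isoFun K (stdAssoc n))) = 0 := by
      refine AbarDual.comul_eq_iff.2 fun x y => ?_
      rw [AbarDual.relabel_single, Equiv.symm_symm, isoFun_stdAssoc_prod hs ht, map_zero,
        LinearMap.zero_apply]
    simp only [this, map_zero]
  · exact fun h => absurd (Finset.mem_univ _) h
  · exact fun h => absurd (Finset.mem_univ _) h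

/-- The component of a primitive element in a positive degree is determined by its value at the
associahedron. -/
theorem apply_eq_smul_of_mem_primitives {f : FullFock K} (hf : f ∈ primitives K) {n : ℕ}
    (hn : n ≠ 0) : f n = f n (Finsupp.single (stdAssoc n) 1) • isoFun K (stdAssoc n) := by
  classical
  refine AbarDual.ext fun w => ?_
  have hinv : ∀ (σ : Equiv.Perm (Fin n)) w,
      f n (Finsupp.single (w.relabel σ) 1) = f n (Finsupp.single w 1) := fun σ w => by
    have := LinearMap.congr_fun (hf.1 n σ.symm) (Finsupp.single w 1)
    rwa [AbarDual.relabel_single, Equiv.symm_symm] at this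
  rw [LinearMap.smul_apply, isoFun_single K Iff.rfl]
  split_ifs with hiso
  · obtain ⟨σ, rfl⟩ := hiso
    rw [hinv, smul_eq_mul, mul_one]
  · obtain ⟨g, r, h⟩ := exists_hasBlocks w
    rw [h.isIso_stdAssoc_iff] at hiso
    obtain ⟨s, t, hs, ht, e, x, y, rfl⟩ := h.exists_eq_prod hiso
    obtain rfl : s + t = n := by simpa using Fintype.card_congr e
    have hrel : (x.prod y).relabel e = ((x.prod y).relabel finSumFinEquiv).relabel
        (finSumFinEquiv.symm.trans e) := by
      rw [AssocClass.relabel_relabel, ← Equiv.trans_assoc, Equiv.self_trans_symm,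
        Equiv.refl_trans]
    rw [hrel, hinv, apply_prod_of_mem_primitives hf, FullFock.one_apply_of_ne (by omega),
      FullFock.one_apply_of_ne (by omega)]
    simp

theorem apply_zero_of_mem_primitives {f : FullFock K} (hf : f ∈ primitives K) : f 0 = 0 := by
  have hsub : ∀ x y : AssocClass (Fin 0), x = y := fun x y => by
    obtain ⟨g, r, hx⟩ := exists_hasBlocks x
    obtain ⟨g', r', hy⟩ := exists_hasBlocks y
    exact hx.unique (hy.congr (fun i => i.elim0) fun i => i.elim0)
  refine AbarDual.ext fun w => ?_
  -- In degree `0`, primitivity at the point class reads `f(pt) = f(pt) + f(pt)`.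
  have := apply_prod_of_mem_primitives hf w w
  rw [FullFock.one_apply_zero, unitFun_single, mul_one, one_mul] at this
  rw [hsub ((w.prod w).relabel finSumFinEquiv) w] at this
  simpa using this

theorem primitives_eq_span : primitives K =
    Submodule.span K (Set.range fun n : ℕ => assocDual K (n + 1)) := by
  classical
  refine le_antisymm (fun f hf => ?_) (Submodule.span_le.2 ?_)
  · rw [← DirectSum.sum_support_of f]
    refine Submodule.sum_mem _ fun n _ => ?_
    rcases n with _ | n
    · rw [apply_zero_of_mem_primitives hf, map_zero]
      exact zero_mem _
    · rw [apply_eq_smul_of_mem_primitives hf n.succ_ne_zero]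
      change FullFock.of K (n + 1) _ ∈ _
      rw [map_smul]
      exact Submodule.smul_mem _ _ (Submodule.subset_span ⟨n, rfl⟩)
  · rintro _ ⟨n, rfl⟩
    exact assocDual_mem_primitives n.succ_ne_zero

theorem linearIndependent_assocDual :
    LinearIndependent K fun n : ℕ => assocDual K (n + 1) := by
  classical
  have hcoef : ∀ (s : Finset ℕ) (g : ℕ → K), ∀ n ∈ s,
      (∑ i ∈ s, g i • assocDual K (i + 1)) (n + 1) (Finsupp.single (stdAssoc (n + 1)) 1) = g n := by
    intro s g n hn
    rw [DirectSum.sum_apply, LinearMap.sum_apply, Finset.sum_eq_single_of_mem n hn]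
    · rw [DirectSum.smul_apply, LinearMap.smul_apply, assocDual, isoDual_eq, DirectSum.lof_apply,
        isoFun_single K (p := True) (iff_true_intro ⟨Equiv.refl _, AssocClass.relabel_refl _⟩),
        if_pos trivial, smul_eq_mul, mul_one]
    · intro m _ hm
      have h0 : assocDual K (m + 1) (n + 1) = 0 := DFinsupp.single_eq_of_ne (by omega)
      rw [DirectSum.smul_apply, LinearMap.smul_apply, h0, LinearMap.zero_apply, smul_zero]
  refine linearIndependent_iff'ₛ.2 fun s g g' h n hn => ?_
  rw [← hcoef s g n hn, h, hcoef s g' n hn]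

/-! ### The Lie algebra of primitive elements -/

/-- The commutator as a bilinear map. -/
def bracketHom (K : Type*) [Field K] : FullFock K →ₗ[K] FullFock K →ₗ[K] FullFock K :=
  LinearMap.mk₂ K (bracket K)
    (fun f f' g => by simp only [bracket, map_add, LinearMap.add_apply]; abel)
    (fun k f g => by simp only [bracket, map_smul, LinearMap.smul_apply, smul_sub])
    (fun f g g' => by simp only [bracket, map_add, LinearMap.add_apply]; abel)
    (fun k f g => by simp only [bracket, map_smul, LinearMap.smul_apply, smul_sub])

theorem bracketHom_apply (f g : FullFock K) : bracketHom K f g = bracket K f g := rfl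

theorem bracketHom_assocDual (m n : ℕ) :
    bracketHom K (assocDual K (m + 1)) (assocDual K (n + 1)) =
      ((m : K) - n) • assocDual K (m + n + 1 + 1) := by
  rw [bracketHom_apply, bracket_assocDual (by omega) (by omega),
    show m + 1 + (n + 1) = m + n + 1 + 1 by omega]
  push_cast
  congr 1
  ring

theorem bracket_mem_primitives {x y : FullFock K} (hx : x ∈ primitives K)
    (hy : y ∈ primitives K) : bracket K x y ∈ primitives K := by
  rw [primitives_eq_span] at hx hy
  rw [← bracketHom_apply]
  induction hx using Submodule.span_induction with
  | zero => simp
  | add a c _ _ ha hc => rw [map_add, LinearMap.add_apply]; exact add_mem ha hc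
  | smul k a _ ha => rw [map_smul, LinearMap.smul_apply]; exact Submodule.smul_mem _ _ ha
  | mem a ha =>
    obtain ⟨m, rfl⟩ := ha
    induction hy using Submodule.span_induction with
    | zero => simp
    | add a c _ _ ha hc => rw [map_add]; exact add_mem ha hc
    | smul k a _ ha => rw [map_smul]; exact Submodule.smul_mem _ _ ha
    | mem a ha =>
      obtain ⟨n, rfl⟩ := ha
      simp only [bracketHom_assocDual]
      exact Submodule.smul_mem _ _ (assocDual_mem_primitives (Nat.succ_ne_zero _))

theorem jacobi {x y z : FullFock K} (hx : x ∈ primitives K) (hy : y ∈ primitives K)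
    (hz : z ∈ primitives K) :
    bracket K x (bracket K y z) + bracket K y (bracket K z x) + bracket K z (bracket K x y) = 0 := by
  rw [primitives_eq_span] at hx hy hz
  simp only [← bracketHom_apply]
  have hadd : ∀ {p q r p' q' r' : FullFock K}, p + q + r = 0 → p' + q' + r' = 0 →
      p + p' + (q + q') + (r + r') = 0 := by
    intro p q r p' q' r' h h'
    rw [show p + p' + (q + q') + (r + r') = (p + q + r) + (p' + q' + r') by abel, h, h', add_zero]
  induction hx using Submodule.span_induction with
  | zero => simp
  | add a c _ _ ha hc =>
    simp only [map_add, LinearMap.add_apply]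
    exact hadd ha hc
  | smul k a _ ha =>
    simp only [map_smul, LinearMap.smul_apply]
    rw [← smul_add, ← smul_add, ha, smul_zero]
  | mem a ha =>
  obtain ⟨l, rfl⟩ := ha
  induction hy using Submodule.span_induction with
  | zero => simp
  | add a c _ _ ha hc =>
    simp only [map_add, LinearMap.add_apply]
    exact hadd ha hc
  | smul k a _ ha =>
    simp only [map_smul, LinearMap.smul_apply]
    rw [← smul_add, ← smul_add, ha, smul_zero]
  | mem a ha =>
  obtain ⟨m, rfl⟩ := ha
  induction hz using Submodule.span_induction with
  | zero => simp
  | add a c _ _ ha hc =>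
    simp only [map_add, LinearMap.add_apply]
    exact hadd ha hc
  | smul k a _ ha =>
    simp only [map_smul, LinearMap.smul_apply]
    rw [← smul_add, ← smul_add, ha, smul_zero]
  | mem a ha =>
  obtain ⟨n, rfl⟩ := ha
  -- On basis elements, the identity is the vanishing of the cyclic sum of `(b - c)(a - b - c - 1)`,
  -- with the indices shifted by one.
  have h : ∀ a b c : ℕ, bracketHom K (assocDual K (a + 1))
      (bracketHom K (assocDual K (b + 1)) (assocDual K (c + 1))) =
      (((b : K) - c) * ((a : K) - (b + c + 1))) • assocDual K (a + b + c + 1 + 1 + 1) := by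
    intro a b c
    rw [bracketHom_assocDual, map_smul, bracketHom_assocDual, smul_smul,
      show a + (b + c + 1) + 1 + 1 = a + b + c + 1 + 1 + 1 by omega]
    push_cast
    rfl
  rw [h, h, h, show m + n + l = l + m + n by omega, show n + l + m = l + m + n by omega,
    ← add_smul, ← add_smul]
  convert zero_smul K _
  ring

end Primitive

end DualAssoc

end

theorem mainTheorem2 (K : Type*) [Field K] [CharZero K] :
    DualAssoc.primitives K =
      Submodule.span K (Set.range fun n : ℕ => DualAssoc.assocDual K (n + 1)) ∧
    LinearIndependent K (fun n : ℕ => DualAssoc.assocDual K (n + 1)) ∧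
    (∀ x ∈ DualAssoc.primitives K, ∀ y ∈ DualAssoc.primitives K,
      DualAssoc.bracket K x y ∈ DualAssoc.primitives K) ∧
    (∀ x ∈ DualAssoc.primitives K, ∀ y ∈ DualAssoc.primitives K, ∀ z ∈ DualAssoc.primitives K,
      DualAssoc.bracket K x (DualAssoc.bracket K y z) +
        DualAssoc.bracket K y (DualAssoc.bracket K z x) +
        DualAssoc.bracket K z (DualAssoc.bracket K x y) = 0) ∧
    (∀ s t : ℕ, 1 ≤ s → 1 ≤ t →
      DualAssoc.bracket K (DualAssoc.assocDual K s) (DualAssoc.assocDual K t) =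
        ((s : K) - (t : K)) • DualAssoc.assocDual K (s + t)) ∧
    (∀ s t : ℕ, 1 ≤ s → 1 ≤ t →
      DualAssoc.FullFock.mul K (DualAssoc.assocDual K s) (DualAssoc.assocDual K t) =
        ((s : K) + 1) • DualAssoc.assocDual K (s + t) +
          (if s = t then (2 : K) else 1) • DualAssoc.assocProdDual K s t) :=
  ⟨DualAssoc.primitives_eq_span, DualAssoc.linearIndependent_assocDual,
    fun _ hx _ hy => DualAssoc.bracket_mem_primitives hx hy,
    fun _ hx _ hy _ hz => DualAssoc.jacobi hx hy hz,
    fun _ _ hs ht => DualAssoc.bracket_assocDual hs ht,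
    fun _ _ hs ht => DualAssoc.mul_assocDual hs ht⟩
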